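/- **Theorem.** Let $G$ be a finite oriented graph (an orientation of a finite simple graph) that is properly subcubic, i.e. every vertex has degree at most $3$ and some vertex has degree at most $2$; if $G$ is disconnected, assume moreover that every connected component of the underlying graph contains a vertex of degree at most $2$. Here the degree of a vertex is its degree in the underlying graph. Let $QR_7$ be the Paley tournament on $7$ vertices: its vertex set is $\mathbb{Z}/7\mathbb{Z}$, and there is an arc from $i$ to $j$ if and only if $j-i$ is a non-zero square modulo $7$. If no vertex of out-degree $3$ of $G$ is adjacent to a vertex of in-degree $3$, then $G$ admits a homomorphism to $QR_7$, i.e. there is a map $\phi : V(G)\to \mathbb{Z}/7\mathbb{Z}$ such that $\phi(u)\phi(v)$ is an arc of $QR_7$ for every arc $uv$ of $G$. In particular, this holds if $G$ has no source of degree $3$ and no sink of degree $3$. -/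

import Mathlib

namespace Digraph

variable {V W : Type*}

/-- An oriented graph: a loopless digraph with at most one arc between any two vertices, that is,
an orientation of a simple graph (asymmetry of `Adj` rules out loops as well). -/
def IsOriented (G : Digraph V) : Prop :=
  ∀ u v : V, G.Adj u v → ¬ G.Adj v u

/-- The out-neighbourhood `N⁺(x)`. -/
def outNeighbors (G : Digraph V) (x : V) : Set V := {y | G.Adj x y}

/-- The in-neighbourhood `N⁻(x)`. -/
def inNeighbors (G : Digraph V) (x : V) : Set V := {y | G.Adj y x}

/-- The out-degree of a vertex. -/
noncomputable def outDegree (G : Digraph V) (x : V) : ℕ := (G.outNeighbors x).ncard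

/-- The in-degree of a vertex. -/
noncomputable def inDegree (G : Digraph V) (x : V) : ℕ := (G.inNeighbors x).ncard

/-- The degree `|N⁺(x) ∪ N⁻(x)|` of a vertex. -/
noncomputable def degree (G : Digraph V) (x : V) : ℕ :=
  (G.outNeighbors x ∪ G.inNeighbors x).ncard

/-- A source: a vertex with no in-neighbour. -/
def IsSource (G : Digraph V) (x : V) : Prop := G.inNeighbors x = ∅

/-- A sink: a vertex with no out-neighbour. -/
def IsSink (G : Digraph V) (x : V) : Prop := G.outNeighbors x = ∅

/-- Subcubic: every vertex has degree at most three. -/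
def IsSubcubic (G : Digraph V) : Prop := ∀ x : V, G.degree x ≤ 3

/-- Properly subcubic: subcubic, and some vertex has degree at most two. -/
def IsProperlySubcubic (G : Digraph V) : Prop :=
  G.IsSubcubic ∧ ∃ x : V, G.degree x ≤ 2

/-- The underlying simple graph of a digraph. -/
def underlying (G : Digraph V) : SimpleGraph V := G.toSimpleGraphInclusive

/-- There is a homomorphism `G → H`: a vertex map that sends arcs to arcs. -/
def AdmitsHom (G : Digraph V) (H : Digraph W) : Prop :=
  ∃ φ : V → W, ∀ u v : V, G.Adj u v → H.Adj (φ u) (φ v)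

/-- The Paley tournament on seven vertices: there is an arc from `i` to `j` if and only if
`j - i` is a non-zero square modulo `7`. -/
def QR7 : Digraph (ZMod 7) where
  Adj i j := j - i ≠ 0 ∧ IsSquare (j - i)

end Digraph

/-!
The proof is a minimal counterexample argument in which vertices of degree at most two are
coloured last. Colours are elements of `Fin 7`. Translations are automorphisms of `QR7`, negation
reverses it, any two vertices have a common out-neighbour and a common in-neighbour, and two
distinct vertices `c`, `d` have a vertex `x` with `c → x → d`. Hence a vertex `v` of degree at
most two can be coloured after the rest, unless its neighbours `u`, `w` have the same colour and
form a path `u → v → w` or `w → v → u`. So it has to be shown that the graph without `v` has a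
colouring in which `u` and `w` get different colours (`Pivot.exists_ne`).

To this end the neighbour `u` is deleted as well. If it has further neighbours `a → u → b`, an arc
`b → a` is added; if it has further out-neighbours `a`, `b`, an arc `a → w` is added; the
remaining case is dual. In a colouring in which the new arc is respected, `u` can be given a
colour different from that of `w`. There are three reasons why minimality may not provide such a
colouring.
* The arc `b → a` or `a → w` is blocked by an arc in the opposite direction. Then `a`, `b`, `u`
  form a transitive triangle, or `a`, `b`, `u`, `w` a directed 4-cycle, which are treated directly
  (`Pivot.exists_ne_of_triangle`, `Pivot.exists_ne_of_cycle`).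
* The new arc completes a component in which all degrees are three. Then the part of the graph
  that it joins is otherwise separate, and a translation of the colours on it helps
  (`Gadget.exists_closed`).
* The new graph violates the assumption on vertices of out-degree and in-degree three. That
  assumption itself is not suited to induction. It is weakened to the exclusion of two
  configurations that force different colours on two vertices which are not visibly related:
  `Obs`, up to reversal, and `Block`. If the new arc creates one of them, then its position there
  is restricted, and a finite search shows that the configuration without the new arc can be
  recoloured so that `u` can still be coloured, up to some exceptional colourings of its boundary
  (`search_boundary`, `searchBlock_boundary`, `Gadget.exists_ok_of_obs`). The exceptional
  colourings give the same colour to several boundary vertices. They are avoided by another appeal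
  to minimality: the deleted part is replaced by a directed path of length two between two
  boundary vertices, which forces them to have different colours (`Crit.exists_ne_or`).
-/

namespace PaleySeven

/-! ### Arithmetic of the Paley tournament -/

/-- The adjacency of `QR7` as a Boolean table on `Fin 7`: the bits of `22` mark the non-zero squares
`1`, `2`, `4`. This form is fast to evaluate in the kernel. -/
def adj (i j : Fin 7) : Bool := Nat.testBit 22 ((j.val + 7 - i.val) % 7)

theorem adj_iff (i j : ZMod 7) : Digraph.QR7.Adj i j ↔ adj i j = true := by
  have h : ∀ i j : Fin 7, (j - i ≠ 0 ∧ ∃ r, j - i = r * r) ↔ adj i j = true := by decide +kernel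
  exact h i j

theorem adj_irrefl : ∀ x, adj x x = false := by decide

theorem adj_add : ∀ x y z : Fin 7, adj (x + z) (y + z) = adj x y := by decide +kernel

theorem adj_neg : ∀ x y : Fin 7, adj (-x) (-y) = adj y x := by decide

/-- `rel true x y` says that `x → y`, and `rel false x y` that `y → x`. -/
def rel (σ : Bool) (x y : Fin 7) : Bool := if σ then adj x y else adj y x

theorem rel_add (σ : Bool) (x y z : Fin 7) : rel σ (x + z) (y + z) = rel σ x y := by
  cases σ <;> simp [rel, adj_add]

theorem exists_rel_ne : ∀ σ c d, ∃ x, rel σ x c = true ∧ x ≠ d := by decide +kernel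

theorem exists_rel_rel : ∀ σ c d, ∃ x, rel σ x c = true ∧ rel σ x d = true := by decide +kernel

theorem exists_rel_rel_of_ne :
    ∀ σ τ c d, c ≠ d → ∃ x, rel σ x c = true ∧ rel τ x d = true := by decide +kernel

/-- The transitive triangle `a → x → b`, `a → b` with one further constraint on each of `a`, `b`
can be coloured with `x` avoiding a given colour `w`, except when `a` has out-degree three, `b` has
in-degree three, and `w` is the colour of both further neighbours. -/
theorem exists_triangle : ∀ σ τ c d w, ¬ (σ = true ∧ τ = false ∧ d = c ∧ w = c) →
    ∃ a, rel σ a c = true ∧ ∃ b, rel τ b d = true ∧ adj a b = true ∧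
      ∃ x, adj a x = true ∧ adj x b = true ∧ x ≠ w := by
  decide +kernel

/-! ### Colourings of an obstruction with one arc removed -/

/-- Tails of the eight arcs of an obstruction; the vertices `0, …, 6` are the tops `T₁, T₂`,
the bottoms `A, B`, the apex `p`, and the outer vertices `o`, `i`. The arcs are, in order,
`T₁A, T₁B, T₂A, T₂B, pA, Bp, T₁o, iT₂`. -/
def src : Fin 8 → Fin 7 := ![0, 0, 1, 1, 4, 3, 0, 6]

/-- Heads of the eight arcs of an obstruction. -/
def tgt : Fin 8 → Fin 7 := ![2, 3, 2, 3, 2, 4, 5, 1]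

/-- Existential quantification over the colours as a Boolean, which the kernel evaluates lazily. -/
def anyColor (f : Fin 7 → Bool) : Bool :=
  f 0 || f 1 || f 2 || f 3 || f 4 || f 5 || f 6

theorem anyColor_iff (f : Fin 7 → Bool) : anyColor f = true ↔ ∃ c, f c = true := by
  simp [anyColor, Fin.exists_fin_succ, or_assoc]

/-- Universal quantification over the colours as a Boolean. -/
def allColor (f : Fin 7 → Bool) : Bool :=
  f 0 && f 1 && f 2 && f 3 && f 4 && f 5 && f 6

theorem allColor_iff (f : Fin 7 → Bool) : allColor f = true ↔ ∀ c, f c = true := by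
  simp [allColor, Fin.forall_fin_succ, and_assoc]

/-- Search for a colouring of an obstruction with arc `k` removed, given the colours of `o` and `i`,
a condition `L` on the colour of `p` and a condition `Q` on the whole colouring. -/
def search (k : Fin 8) (L : Fin 7 → Bool) (Q : (Fin 7 → Fin 7) → Bool) (o i : Fin 7) : Bool :=
  anyColor fun t₁ => (k == 6 || adj t₁ o) && anyColor fun t₂ => (k == 7 || adj i t₂) &&
  anyColor fun p => L p &&
  anyColor fun a => (k == 0 || adj t₁ a) && (k == 2 || adj t₂ a) && (k == 4 || adj p a) &&
  anyColor fun b => (k == 1 || adj t₁ b) && (k == 3 || adj t₂ b) && (k == 5 || adj b p) &&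
    Q ![t₁, t₂, a, b, p, o, i]

/-- The variant of `search` for obstructions in which `o = T₂` and `i = T₁`, so that the arcs `6`
and `7` are the same arc `T₁T₂`. -/
def searchDiamond (k : Fin 8) (L : Fin 7 → Bool) (Q : (Fin 7 → Fin 7) → Bool) : Bool :=
  anyColor fun t₁ => anyColor fun t₂ => (k == 6 || k == 7 || adj t₁ t₂) &&
  anyColor fun p => L p &&
  anyColor fun a => (k == 0 || adj t₁ a) && (k == 2 || adj t₂ a) && (k == 4 || adj p a) &&
  anyColor fun b => (k == 1 || adj t₁ b) && (k == 3 || adj t₂ b) && (k == 5 || adj b p) &&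
    Q ![t₁, t₂, a, b, p, t₂, t₁]

theorem exists_of_search {k : Fin 8} {L : Fin 7 → Bool} {Q : (Fin 7 → Fin 7) → Bool} {o i : Fin 7}
    (h : search k L Q o i = true) :
    ∃ c : Fin 7 → Fin 7, c 5 = o ∧ c 6 = i ∧ (∀ j, j = k ∨ adj (c (src j)) (c (tgt j)) = true) ∧
      L (c 4) = true ∧ Q c = true := by
  simp only [search, anyColor_iff, Bool.and_eq_true, Bool.or_eq_true, beq_iff_eq] at h
  obtain ⟨t₁, h6, t₂, h7, p, hp, a, ⟨⟨h0, h2⟩, h4⟩, b, ⟨⟨⟨h1, h3⟩, h5⟩, hQ⟩⟩ := h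
  refine ⟨![t₁, t₂, a, b, p, o, i], rfl, rfl, ?_, hp, hQ⟩
  simp only [Fin.forall_fin_succ, IsEmpty.forall_iff, and_true]
  exact ⟨h0.imp_left Eq.symm, h1.imp_left Eq.symm, h2.imp_left Eq.symm, h3.imp_left Eq.symm,
    h4.imp_left Eq.symm, h5.imp_left Eq.symm, h6.imp_left Eq.symm, h7.imp_left Eq.symm⟩

theorem exists_of_searchDiamond {k : Fin 8} {L : Fin 7 → Bool} {Q : (Fin 7 → Fin 7) → Bool}
    (h : searchDiamond k L Q = true) :
    ∃ c : Fin 7 → Fin 7, c 5 = c 1 ∧ c 6 = c 0 ∧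
      (∀ j, j = k ∨ (6 ≤ j ∧ 6 ≤ k) ∨ adj (c (src j)) (c (tgt j)) = true) ∧
      L (c 4) = true ∧ Q c = true := by
  simp only [searchDiamond, anyColor_iff, Bool.and_eq_true, Bool.or_eq_true, beq_iff_eq] at h
  obtain ⟨t₁, t₂, h6, p, hp, a, ⟨⟨h0, h2⟩, h4⟩, b, ⟨⟨⟨h1, h3⟩, h5⟩, hQ⟩⟩ := h
  have h67 : (6 ≤ k) ∨ adj t₁ t₂ = true := by
    rcases h6 with (rfl | rfl) | h6
    · exact Or.inl (by decide)
    · exact Or.inl (by decide)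
    · exact Or.inr h6
  refine ⟨![t₁, t₂, a, b, p, t₂, t₁], rfl, rfl, ?_, hp, hQ⟩
  simp only [Fin.forall_fin_succ, IsEmpty.forall_iff, and_true]
  exact ⟨h0.imp Eq.symm .inr, h1.imp Eq.symm .inr, h2.imp Eq.symm .inr, h3.imp Eq.symm .inr,
    h4.imp Eq.symm .inr, h5.imp Eq.symm .inr,
    .inr (h67.imp_left fun h => ⟨by decide, h⟩), .inr (h67.imp_left fun h => ⟨by decide, h⟩)⟩

/-- The three situations in which an arc `s → t` is added after a vertex `x` has been removed:
`x` had neighbours `a → x → b` and the new arc is `b → a`; or it had out-neighbours `a`, `b` and the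
new arc is `a → w`; or it had in-neighbours `a`, `b` and the new arc is `w → a`. In each situation
`w` is a vertex whose colour `x` has to avoid. -/
inductive Kind
  | through
  | out
  | into
  deriving DecidableEq

/-- The condition on the colours of the ends `s`, `t` of the new arc and of the remaining vertex `e`
of `a`, `b`, `w` under which the removed vertex `x` can be coloured. -/
def Kind.ok : Kind → Fin 7 → Fin 7 → Fin 7 → Bool
  | .through, s, t, e => adj s t || (adj t s && !(adj t e && adj e s))
  | .out, s, t, e => s == e || !(adj t s && adj t e)
  | .into, s, t, e => t == e || !(adj t s && adj e s)

theorem Kind.ok_through : ∀ s t e, Kind.through.ok s t e = true →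
    ∃ x, adj t x = true ∧ adj x s = true ∧ x ≠ e := by decide +kernel

theorem Kind.ok_out : ∀ s t e, Kind.out.ok s t e = true →
    ∃ x, adj x s = true ∧ adj x e = true ∧ x ≠ t := by decide +kernel

theorem Kind.ok_add (κ : Kind) (s t e z : Fin 7) :
    κ.ok (s + z) (t + z) (e + z) = κ.ok s t e := by
  cases κ <;> simp [Kind.ok, adj_add, Bool.beq_eq_decide_eq]

/-- The pairs (removed arc `k`, direction of the third edge at `p`) that can occur. In the kinds
`out` and `into` the vertex `w` does not have both an in- and an out-neighbour besides `x`. -/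
def Kind.valid : Kind → Fin 8 → Bool → Bool
  | .through, _, _ => true
  | .out, k, σ => k != 1 && k != 3 && (k != 5 || σ)
  | .into, k, σ => k != 2 && k != 3 && (k != 4 || !σ)

/-- The exceptional colourings of the boundary, with the colour `0` at `o`, and colours `i`, `q`,
`e` at `i`, at the third neighbour of `p` and at the third vertex. -/
def Kind.exceptional : Kind → Fin 8 → Bool → Fin 7 → Fin 7 → Fin 7 → Bool
  | .through, k, σ, i, q, _ => k == 3 && σ && i == 0 && q == 0
  | .out, k, σ, i, q, e => k == 5 && σ && i == 0 && q == 0 && e == 0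
  | .into, k, σ, i, q, e => k == 4 && !σ && i == 0 && q == 0 && e == 0

set_option maxRecDepth 10000 in
/-- Up to the exceptional cases, an obstruction without its arc `k` can be coloured for all colours
on its boundary. By translation, the colour of `o` may be taken to be `0`. -/
theorem search_boundary (κ : Kind) (k : Fin 8) (σ : Bool) :
    (!κ.valid k σ || allColor fun i => allColor fun q => allColor fun e =>
      κ.exceptional k σ i q e ||
        search k (rel σ · q) (fun c => κ.ok (c (src k)) (c (tgt k)) e) 0 i) = true := by
  revert κ k σ
  have h : ∀ κ ∈ [Kind.through, .out, .into], ∀ k : Fin 8, ∀ σ : Bool,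
    (!κ.valid k σ || allColor fun i => allColor fun q => allColor fun e =>
      κ.exceptional k σ i q e ||
        search k (rel σ · q) (fun c => κ.ok (c (src k)) (c (tgt k)) e) 0 i) = true := by
    decide +kernel
  exact fun κ => h κ (by cases κ <;> decide)

/-- The case in which the third vertex is the apex of the obstruction, so that there is no third
edge at the apex. -/
theorem search_apex (κ : Kind) (k : Fin 8) (hk : κ.valid k true || κ.valid k false)
    (h4 : k ≠ 4) (h5 : k ≠ 5) (i : Fin 7) :
    search k (fun _ => true) (fun c => κ.ok (c (src k)) (c (tgt k)) (c 4)) 0 i = true := by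
  revert i h5 h4 hk k κ
  have h : ∀ κ ∈ [Kind.through, .out, .into], ∀ k : Fin 8, κ.valid k true || κ.valid k false →
    k ≠ 4 → k ≠ 5 → ∀ i,
    search k (fun _ => true) (fun c => κ.ok (c (src k)) (c (tgt k)) (c 4)) 0 i = true := by
    decide +kernel
  exact fun κ => h κ (by cases κ <;> decide)

theorem searchDiamond_boundary (κ : Kind) (k : Fin 8) (σ : Bool) (hk : κ.valid k σ)
    (hκ : κ = .through → k ≠ 6 ∧ k ≠ 7) (q e : Fin 7) :
    searchDiamond k (rel σ · q) (fun c => κ.ok (c (src k)) (c (tgt k)) e) = true := by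
  revert e q hκ hk σ k κ
  have h : ∀ κ ∈ [Kind.through, .out, .into], ∀ k : Fin 8, ∀ σ, κ.valid k σ →
    (κ = .through → k ≠ 6 ∧ k ≠ 7) → ∀ q e,
    searchDiamond k (rel σ · q) (fun c => κ.ok (c (src k)) (c (tgt k)) e) = true := by
    decide +kernel
  exact fun κ => h κ (by cases κ <;> decide)

theorem searchDiamond_apex (κ : Kind) (k : Fin 8) (hk : κ.valid k true || κ.valid k false)
    (hκ : κ = .through → k ≠ 6 ∧ k ≠ 7) (h4 : k ≠ 4) (h5 : k ≠ 5) :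
    searchDiamond k (fun _ => true) (fun c => κ.ok (c (src k)) (c (tgt k)) (c 4)) = true := by
  revert h5 h4 hκ hk k κ
  have h : ∀ κ ∈ [Kind.through, .out, .into], ∀ k : Fin 8, κ.valid k true || κ.valid k false →
    (κ = .through → k ≠ 6 ∧ k ≠ 7) → k ≠ 4 → k ≠ 5 →
    searchDiamond k (fun _ => true) (fun c => κ.ok (c (src k)) (c (tgt k)) (c 4)) = true := by
    decide +kernel
  exact fun κ => h κ (by cases κ <;> decide)

/-! ### Colourings of a block with one arc removed -/

/-- Tails of the seven arcs of a block; the vertices `0, …, 5` are the source `S`, the sink `T`, the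
middle vertices `M`, `N`, and the outer vertices `o`, `i`. The arcs are, in order,
`ST, SM, SN, MT, NT, Mo, iN`. -/
def bsrc : Fin 7 → Fin 6 := ![0, 0, 0, 2, 3, 2, 5]

/-- Heads of the seven arcs of a block. -/
def btgt : Fin 7 → Fin 6 := ![1, 2, 3, 1, 1, 4, 3]

/-- Search for a colouring of a block with arc `k` removed, given the colours of `o` and `i`. -/
def searchBlock (k : Fin 7) (Q : (Fin 6 → Fin 7) → Bool) (o i : Fin 7) : Bool :=
  anyColor fun m => (k == 5 || adj m o) && anyColor fun n => (k == 6 || adj i n) &&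
  anyColor fun s => (k == 1 || adj s m) && (k == 2 || adj s n) &&
  anyColor fun t => (k == 0 || adj s t) && (k == 3 || adj m t) && (k == 4 || adj n t) &&
    Q ![s, t, m, n, o, i]

theorem exists_of_searchBlock {k : Fin 7} {Q : (Fin 6 → Fin 7) → Bool} {o i : Fin 7}
    (h : searchBlock k Q o i = true) :
    ∃ c : Fin 6 → Fin 7, c 4 = o ∧ c 5 = i ∧ (∀ j, j = k ∨ adj (c (bsrc j)) (c (btgt j)) = true) ∧
      Q c = true := by
  simp only [searchBlock, anyColor_iff, Bool.and_eq_true, Bool.or_eq_true, beq_iff_eq] at h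
  obtain ⟨m, h5, n, h6, s, ⟨h1, h2⟩, t, ⟨⟨⟨h0, h3⟩, h4⟩, hQ⟩⟩ := h
  refine ⟨![s, t, m, n, o, i], rfl, rfl, ?_, hQ⟩
  simp only [Fin.forall_fin_succ, IsEmpty.forall_iff, and_true]
  exact ⟨h0.imp_left Eq.symm, h1.imp_left Eq.symm, h2.imp_left Eq.symm, h3.imp_left Eq.symm,
    h4.imp_left Eq.symm, h5.imp_left Eq.symm, h6.imp_left Eq.symm⟩

theorem searchBlock_boundary (κ : Kind) (k : Fin 7) (i e : Fin 7) :
    searchBlock k (fun c => κ.ok (c (bsrc k)) (c (btgt k)) e) 0 i = true := by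
  revert e i k κ
  have h : ∀ κ ∈ [Kind.through, .out, .into], ∀ k i e : Fin 7,
    searchBlock k (fun c => κ.ok (c (bsrc k)) (c (btgt k)) e) 0 i = true := by
    decide +kernel
  exact fun κ => h κ (by cases κ <;> decide)

variable {V : Type*}

/-! ### Admissible relations -/

/-- Adjacency in the underlying graph of a relation. -/
def Nbr (R : V → V → Prop) (x y : V) : Prop := R x y ∨ R y x

/-- `x` has at least three neighbours. -/
def Full (R : V → V → Prop) (x : V) : Prop :=
  ∃ y₁ y₂ y₃, y₁ ≠ y₂ ∧ y₁ ≠ y₃ ∧ y₂ ≠ y₃ ∧ Nbr R x y₁ ∧ Nbr R x y₂ ∧ Nbr R x y₃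

/-- A union of connected components of the underlying graph. -/
def Closed (R : V → V → Prop) (X : Set V) : Prop := ∀ x ∈ X, ∀ y, Nbr R x y → y ∈ X

def Asymm (R : V → V → Prop) : Prop := ∀ x y, R x y → ¬ R y x

/-- Every vertex has at most three neighbours. -/
def Subcubic (R : V → V → Prop) : Prop :=
  ∀ x y₁ y₂ y₃, y₁ ≠ y₂ → y₁ ≠ y₃ → y₂ ≠ y₃ → Nbr R x y₁ → Nbr R x y₂ → Nbr R x y₃ →
    ∀ y, Nbr R x y → y = y₁ ∨ y = y₂ ∨ y = y₃

/-- Every connected component contains a vertex with at most two neighbours. -/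
def LowComponents (R : V → V → Prop) : Prop :=
  ∀ X : Set V, X.Nonempty → Closed R X → ∃ x ∈ X, ¬ Full R x

/-- An obstruction: a 4-cycle directed from `T₁, T₂` to `A, B`, an apex `p` with `B → p → A`, and
arcs `T₁ → o`, `i → T₂`. The apex forces different colours on `A` and `B`, hence the same colour on
`T₁` and `T₂`, and hence different colours on `o` and `i`. The case `o = T₂`, `i = T₁` is allowed;
then there is no colouring at all. -/
structure Obs (R : V → V → Prop) (X : Fin 7 → V) : Prop where
  arc : ∀ k, R (X (src k)) (X (tgt k))
  ne01 : X 0 ≠ X 1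
  ne23 : X 2 ≠ X 3
  ne52 : X 5 ≠ X 2
  ne53 : X 5 ≠ X 3
  ne54 : X 5 ≠ X 4
  ne64 : X 6 ≠ X 4

/-- A block: an arc `S → T`, two directed paths `S → M → T` and `S → N → T`, and arcs `M → o`,
`i → N`. The vertices `M` and `N` get the same colour, hence `o` and `i` different ones. -/
structure Block (R : V → V → Prop) (X : Fin 6 → V) : Prop where
  arc : ∀ k, R (X (bsrc k)) (X (btgt k))
  ne23 : X 2 ≠ X 3
  ne41 : X 4 ≠ X 1
  ne43 : X 4 ≠ X 3
  ne50 : X 5 ≠ X 0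

/-- The class of relations to which the induction applies. It is closed under subrelations and
under reversal. -/
structure Adm (R : V → V → Prop) : Prop where
  asymm : Asymm R
  cubic : Subcubic R
  low : LowComponents R
  noObs : ∀ X, ¬ Obs R X
  noObs' : ∀ X, ¬ Obs (flip R) X
  noBlock : ∀ X, ¬ Block R X

theorem nbr_flip {R : V → V → Prop} {x y : V} : Nbr (flip R) x y ↔ Nbr R x y := or_comm

theorem nbr_comm {R : V → V → Prop} {x y : V} : Nbr R x y ↔ Nbr R y x := or_comm

theorem full_flip {R : V → V → Prop} {x : V} : Full (flip R) x ↔ Full R x := by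
  simp only [Full, nbr_flip]

theorem Asymm.flip {R : V → V → Prop} (h : Asymm R) : Asymm (flip R) := fun x y hx hy => h y x hx hy

theorem Subcubic.flip {R : V → V → Prop} (h : Subcubic R) : Subcubic (flip R) := by
  simpa only [Subcubic, nbr_flip] using h

theorem LowComponents.flip {R : V → V → Prop} (h : LowComponents R) : LowComponents (flip R) := by
  simpa only [LowComponents, Closed, full_flip, nbr_flip] using h

/-- Blocks are self-dual under reversal. -/
theorem Block.flip {R : V → V → Prop} (hR : Asymm R) (hd : Subcubic R) {X : Fin 6 → V}
    (h : Block R X) : Block (flip R) ![X 1, X 0, X 3, X 2, X 5, X 4] where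
  arc := by
    have := h.arc
    simp only [Fin.forall_fin_succ, IsEmpty.forall_iff, and_true] at this ⊢
    obtain ⟨h0, h1, h2, h3, h4, h5, h6⟩ := this
    exact ⟨h0, h4, h3, h2, h1, h6, h5⟩
  ne23 := h.ne23.symm
  ne41 := h.ne50
  ne43 := by
    have := h.arc
    simp only [Fin.forall_fin_succ, IsEmpty.forall_iff, and_true] at this
    obtain ⟨h0, h1, h2, h3, h4, h5, h6⟩ := this
    change R (X 2) (X 4) at h5
    change R (X 5) (X 3) at h6
    change R (X 0) (X 1) at h0
    change R (X 0) (X 2) at h1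
    change R (X 2) (X 1) at h3
    change X 5 ≠ X 2
    intro h52
    rw [h52] at h6
    have h04 : X 0 ≠ X 4 := fun e => hR _ _ h1 (e ▸ h5)
    have h01 : X 0 ≠ X 1 := fun e => hR _ _ h1 (e ▸ h3)
    rcases hd (X 2) (X 0) (X 1) (X 4) h01 h04 h.ne41.symm (.inr h1) (.inl h3) (.inl h5)
      (X 3) (.inl h6) with e | e | e
    · exact hR _ _ h1 (e ▸ h6)
    · have h4 : R (X 3) (X 1) := h4
      rw [e] at h4
      exact hR _ _ h4 h4
    · exact h.ne43 e.symm
  ne50 := h.ne41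

theorem Adm.flip {R : V → V → Prop} (h : Adm R) : Adm (flip R) where
  asymm := h.asymm.flip
  cubic := h.cubic.flip
  low := h.low.flip
  noObs := h.noObs'
  noObs' := h.noObs
  noBlock := fun _ hX => h.noBlock _ (hX.flip h.asymm.flip h.cubic.flip)

theorem Nbr.mono {R S : V → V → Prop} (h : ∀ x y, S x y → R x y) {x y : V} (hn : Nbr S x y) :
    Nbr R x y := hn.imp (h _ _) (h _ _)

theorem Full.mono {R S : V → V → Prop} (h : ∀ x y, S x y → R x y) {x : V} (hx : Full S x) :
    Full R x := by
  obtain ⟨a, b, c, h1, h2, h3, ha, hb, hc⟩ := hx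
  exact ⟨a, b, c, h1, h2, h3, ha.mono h, hb.mono h, hc.mono h⟩

/-- A vertex with three neighbours in a subrelation has no further neighbours. -/
theorem Full.nbr_of_nbr {R S : V → V → Prop} (hd : Subcubic R) {x : V}
    (h : ∀ y, Nbr S x y → Nbr R x y) (hx : Full S x) {y : V} (hy : Nbr R x y) : Nbr S x y := by
  obtain ⟨a, b, c, h1, h2, h3, ha, hb, hc⟩ := hx
  rcases hd x a b c h1 h2 h3 (h _ ha) (h _ hb) (h _ hc) y hy with rfl | rfl | rfl <;> assumption

theorem Adm.mono {R S : V → V → Prop} (hR : Adm R) (h : ∀ x y, S x y → R x y) : Adm S where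
  asymm := fun x y hx hy => hR.asymm x y (h _ _ hx) (h _ _ hy)
  cubic := fun x a b c h1 h2 h3 ha hb hc y hy =>
    hR.cubic x a b c h1 h2 h3 (ha.mono h) (hb.mono h) (hc.mono h) y (hy.mono h)
  low := by
    intro X hX hcl
    by_contra! hall
    obtain ⟨x, hx, hxf⟩ := hR.low X hX fun x hx y hy =>
      hcl x hx y ((hall x hx).nbr_of_nbr hR.cubic (fun _ => Nbr.mono h) hy)
    exact hxf ((hall x hx).mono h)
  noObs := fun X hX => hR.noObs X { hX with arc := fun k => h _ _ (hX.arc k) }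
  noObs' := fun X hX => hR.noObs' X { hX with arc := fun k => h _ _ (hX.arc k) }
  noBlock := fun X hX => hR.noBlock X { hX with arc := fun k => h _ _ (hX.arc k) }

/-! ### Colourings, deletion of vertices, and criticality -/

/-- `ψ` is a homomorphism from `R` to `QR7`. -/
def Proper (R : V → V → Prop) (ψ : V → Fin 7) : Prop := ∀ x y, R x y → adj (ψ x) (ψ y) = true

/-- Deletion of a set of vertices; the deleted vertices become isolated. -/
def del (R : V → V → Prop) (D : Set V) (x y : V) : Prop := R x y ∧ x ∉ D ∧ y ∉ D

noncomputable def numArcs (R : V → V → Prop) : ℕ := {e : V × V | R e.1 e.2}.ncard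

/-- An admissible relation such that all admissible relations with fewer arcs are colourable. -/
structure Crit (R : V → V → Prop) : Prop where
  adm : Adm R
  ih : ∀ S : V → V → Prop, Adm S → numArcs S < numArcs R → ∃ ψ, Proper S ψ

theorem Proper.flip {R : V → V → Prop} {ψ : V → Fin 7} (h : Proper R ψ) :
    Proper (flip R) (fun x => -ψ x) := fun x y hxy => by
  rw [adj_neg]; exact h y x hxy

/-- A colouring may be translated on a union of connected components. -/
theorem Proper.shift {R : V → V → Prop} {ψ : V → Fin 7} (h : Proper R ψ) {X : Set V}
    [DecidablePred (· ∈ X)] (hX : Closed R X) (z : Fin 7) :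
    Proper R (fun x => if x ∈ X then ψ x + z else ψ x) := fun x y hxy => by
  have : x ∈ X ↔ y ∈ X := ⟨fun hx => hX x hx y (.inl hxy), fun hy => hX y hy x (.inr hxy)⟩
  by_cases hx : x ∈ X
  · simp only [hx, this.1 hx, if_true, adj_add]; exact h x y hxy
  · simp only [hx, mt this.2 hx, if_false]; exact h x y hxy

theorem Proper.mono {R S : V → V → Prop} {ψ : V → Fin 7} (h : Proper R ψ)
    (hS : ∀ x y, S x y → R x y) : Proper S ψ := fun x y hxy => h x y (hS x y hxy)

theorem Proper.ne {R : V → V → Prop} {ψ : V → Fin 7} (h : Proper R ψ) {x y : V}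
    (hxy : Nbr R x y) : ψ x ≠ ψ y := by
  intro e
  rcases hxy with hxy | hxy <;> · have := h _ _ hxy; rw [e, adj_irrefl] at this; cases this

theorem numArcs_flip (R : V → V → Prop) : numArcs (flip R) = numArcs R := by
  have : {e : V × V | flip R e.1 e.2} = (Equiv.prodComm V V) ⁻¹' {e : V × V | R e.1 e.2} := rfl
  rw [numArcs, this, numArcs, Set.ncard_preimage_of_injective_subset_range]
  · exact (Equiv.prodComm V V).injective
  · exact (Equiv.prodComm V V).range_eq_univ ▸ Set.subset_univ _

theorem Crit.flip {R : V → V → Prop} (h : Crit R) : Crit (flip R) where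
  adm := h.adm.flip
  ih := fun S hS hlt => by
    rw [numArcs_flip] at hlt
    obtain ⟨ψ, hψ⟩ := h.ih (_root_.flip S) hS.flip (by rwa [numArcs_flip])
    exact ⟨_, hψ.flip⟩

theorem numArcs_lt [Finite V] {R S : V → V → Prop} (h : ∀ x y, S x y → R x y) {a b : V}
    (hab : R a b) (hab' : ¬ S a b) : numArcs S < numArcs R :=
  Set.ncard_lt_ncard ⟨fun _ he => h _ _ he, fun hle => hab' (hle (a := (a, b)) hab)⟩
    (Set.toFinite _)

theorem Crit.exists_proper_del [Finite V] {R : V → V → Prop} (h : Crit R) {D : Set V} {a b : V}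
    (ha : a ∈ D) (hab : Nbr R a b) : ∃ ψ, Proper (del R D) ψ := by
  have hle : ∀ x y, del R D x y → R x y := fun x y hxy => hxy.1
  refine h.ih _ (h.adm.mono hle) ?_
  rcases hab with hab | hab
  · exact numArcs_lt hle hab fun h => h.2.1 ha
  · exact numArcs_lt hle hab fun h => h.2.2 ha

/-- Three arcs are lost and at most two are gained. -/
theorem numArcs_lt_of_three [Finite V] {R S : V → V → Prop} {e₁ e₂ e₃ g₁ g₂ : V × V}
    (h₁₂ : e₁ ≠ e₂) (h₁₃ : e₁ ≠ e₃) (h₂₃ : e₂ ≠ e₃)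
    (h₁ : R e₁.1 e₁.2) (h₂ : R e₂.1 e₂.2) (h₃ : R e₃.1 e₃.2)
    (hS : ∀ e : V × V, S e.1 e.2 → e = g₁ ∨ e = g₂ ∨ (R e.1 e.2 ∧ e ≠ e₁ ∧ e ≠ e₂ ∧ e ≠ e₃)) :
    numArcs S < numArcs R := by
  set E := {e : V × V | R e.1 e.2} with hE
  have hsub : {e : V × V | S e.1 e.2} ⊆ {g₁, g₂} ∪ (E \ {e₁, e₂, e₃}) := by
    intro e he
    rcases hS e he with rfl | rfl | ⟨h, h1, h2, h3⟩
    · simp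
    · simp
    · right; simp [hE, h, h1, h2, h3]
  have h3 : ({e₁, e₂, e₃} : Set (V × V)).ncard = 3 :=
    Set.ncard_eq_three.2 ⟨e₁, e₂, e₃, h₁₂, h₁₃, h₂₃, rfl⟩
  have hsub3 : ({e₁, e₂, e₃} : Set (V × V)) ⊆ E := by
    rintro e (rfl | rfl | rfl) <;> assumption
  have hd := Set.ncard_sdiff_add_ncard_of_subset hsub3 (Set.toFinite E)
  have h2 : ({g₁, g₂} : Set (V × V)).ncard ≤ 2 := by
    have := Set.ncard_insert_le g₁ {g₂}
    rwa [Set.ncard_singleton] at this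
  have hu := Set.ncard_union_le ({g₁, g₂} : Set (V × V)) (E \ {e₁, e₂, e₃})
  have hl := Set.ncard_le_ncard hsub (Set.toFinite _)
  change Set.ncard _ < E.ncard
  omega

/-- The neighbours of a vertex besides two given ones: there is at most one. -/
theorem Subcubic.third {R : V → V → Prop} (hd : Subcubic R) {x y₁ y₂ : V} (h12 : y₁ ≠ y₂)
    (h1 : Nbr R x y₁) (h2 : Nbr R x y₂) :
    (∀ y, Nbr R x y → y = y₁ ∨ y = y₂) ∨
      ∃ q, q ≠ y₁ ∧ q ≠ y₂ ∧ Nbr R x q ∧ ∀ y, Nbr R x y → y = y₁ ∨ y = y₂ ∨ y = q := by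
  by_cases h : ∀ y, Nbr R x y → y = y₁ ∨ y = y₂
  · exact .inl h
  · push Not at h
    obtain ⟨q, hq, hq1, hq2⟩ := h
    exact .inr ⟨q, hq1, hq2, hq, hd x y₁ y₂ q h12 hq1.symm hq2.symm h1 h2 hq⟩

/-- The constraint on the colour of `x` imposed by a neighbour `q` has the form `rel σ · (ψ q)`. -/
theorem exists_rel {R : V → V → Prop} (hR : Asymm R) {x q : V} (hq : Nbr R x q) :
    ∃ σ : Bool, (σ = true → R x q) ∧ (σ = false → R q x) ∧ ∀ (c d : Fin 7), rel σ c d = true →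
      (R x q → adj c d = true) ∧ (R q x → adj d c = true) := by
  rcases hq with hq | hq
  · exact ⟨true, fun _ => hq, by simp, fun c d h => ⟨fun _ => h, fun h' => (hR _ _ hq h').elim⟩⟩
  · exact ⟨false, by simp, fun _ => hq, fun c d h => ⟨fun h' => (hR _ _ hq h').elim, fun _ => h⟩⟩

/-- Degrees stay bounded at `x` if the neighbours of `x` can be sent injectively to neighbours in a
subcubic relation. -/
theorem Subcubic.transfer {R S : V → V → Prop} (hd : Subcubic R) {x : V} (f : V → V)
    (hf : ∀ y, Nbr S x y → Nbr R x (f y))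
    (hinj : ∀ y y', Nbr S x y → Nbr S x y' → f y = f y' → y = y') {y₁ y₂ y₃ : V}
    (h12 : y₁ ≠ y₂) (h13 : y₁ ≠ y₃) (h23 : y₂ ≠ y₃) (h1 : Nbr S x y₁) (h2 : Nbr S x y₂)
    (h3 : Nbr S x y₃) {y : V} (hy : Nbr S x y) : y = y₁ ∨ y = y₂ ∨ y = y₃ := by
  rcases hd x (f y₁) (f y₂) (f y₃) (fun e => h12 (hinj _ _ h1 h2 e))
    (fun e => h13 (hinj _ _ h1 h3 e)) (fun e => h23 (hinj _ _ h2 h3 e))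
    (hf _ h1) (hf _ h2) (hf _ h3) (f y) (hf _ hy) with e | e | e
  · exact .inl (hinj _ _ hy h1 e)
  · exact .inr (.inl (hinj _ _ hy h2 e))
  · exact .inr (.inr (hinj _ _ hy h3 e))

/-- If every vertex of a nonempty closed set `X` of `S` has three neighbours, then some vertex of
`X` has a neighbour in `S` that is not a neighbour in `R`. -/
theorem LowComponents.exists_new {R S : V → V → Prop} (hR : LowComponents R) (hd : Subcubic R)
    {X : Set V} (hne : X.Nonempty) (hX : Closed S X) (hfull : ∀ x ∈ X, Full S x) :
    ∃ x ∈ X, ∃ y, Nbr S x y ∧ ¬ Nbr R x y := by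
  by_contra! h
  obtain ⟨x, hx, hxf⟩ := hR X hne fun x hx y hy =>
    hX x hx y ((hfull x hx).nbr_of_nbr hd (h x hx) hy)
  obtain ⟨a, b, c, h1, h2, h3, ha, hb, hc⟩ := hfull x hx
  exact hxf ⟨a, b, c, h1, h2, h3, h x hx _ ha, h x hx _ hb, h x hx _ hc⟩

section Obs

variable {R : V → V → Prop} {X : Fin 7 → V}

theorem Obs.arcs (h : Obs R X) : R (X 0) (X 2) ∧ R (X 0) (X 3) ∧ R (X 1) (X 2) ∧ R (X 1) (X 3) ∧
    R (X 4) (X 2) ∧ R (X 3) (X 4) ∧ R (X 0) (X 5) ∧ R (X 6) (X 1) :=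
  ⟨h.arc 0, h.arc 1, h.arc 2, h.arc 3, h.arc 4, h.arc 5, h.arc 6, h.arc 7⟩

theorem Obs.of_arcs (h0 : R (X 0) (X 2)) (h1 : R (X 0) (X 3)) (h2 : R (X 1) (X 2))
    (h3 : R (X 1) (X 3)) (h4 : R (X 4) (X 2)) (h5 : R (X 3) (X 4)) (h6 : R (X 0) (X 5))
    (h7 : R (X 6) (X 1)) (ne01 : X 0 ≠ X 1) (ne23 : X 2 ≠ X 3) (ne52 : X 5 ≠ X 2)
    (ne53 : X 5 ≠ X 3) (ne54 : X 5 ≠ X 4) (ne64 : X 6 ≠ X 4) : Obs R X where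
  arc := by
    simp only [Fin.forall_fin_succ, IsEmpty.forall_iff, and_true]
    exact ⟨h0, h1, h2, h3, h4, h5, h6, h7⟩
  ne01 := ne01
  ne23 := ne23
  ne52 := ne52
  ne53 := ne53
  ne54 := ne54
  ne64 := ne64

end Obs

section Block

variable {R : V → V → Prop} {X : Fin 6 → V}

theorem Block.arcs (h : Block R X) : R (X 0) (X 1) ∧ R (X 0) (X 2) ∧ R (X 0) (X 3) ∧
    R (X 2) (X 1) ∧ R (X 3) (X 1) ∧ R (X 2) (X 4) ∧ R (X 5) (X 3) :=
  ⟨h.arc 0, h.arc 1, h.arc 2, h.arc 3, h.arc 4, h.arc 5, h.arc 6⟩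

theorem Block.of_arcs (h0 : R (X 0) (X 1)) (h1 : R (X 0) (X 2)) (h2 : R (X 0) (X 3))
    (h3 : R (X 2) (X 1)) (h4 : R (X 3) (X 1)) (h5 : R (X 2) (X 4)) (h6 : R (X 5) (X 3))
    (ne23 : X 2 ≠ X 3) (ne41 : X 4 ≠ X 1) (ne43 : X 4 ≠ X 3) (ne50 : X 5 ≠ X 0) : Block R X where
  arc := by
    simp only [Fin.forall_fin_succ, IsEmpty.forall_iff, and_true]
    exact ⟨h0, h1, h2, h3, h4, h5, h6⟩
  ne23 := ne23
  ne41 := ne41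
  ne43 := ne43
  ne50 := ne50

end Block

/-! ### Separating the colours of boundary vertices -/

section Path

variable {R S : V → V → Prop} {D : Set V} {x y z d₁ d₂ : V}

/-- If `S` consists of arcs of `R` off `D` and a path `y → z → x` through a vertex `z` of `D`, then
obstructions of `S` come from `R` unless `z` is the apex. -/
theorem Obs.of_path (hz : z ∈ D) (hy : y ∉ D) (hx : x ∉ D) (hd₁ : d₁ ∈ D) (hyd : R y d₁)
    (hd₂ : d₂ ∈ D) (hdx : R d₂ x)
    (hS : ∀ a b, S a b → del R D a b ∨ (a = y ∧ b = z) ∨ (a = z ∧ b = x)) {X : Fin 7 → V}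
    (h : Obs S X) :
    (∃ X', Obs R X') ∨
      ∃ t t' i, t ≠ t' ∧ t ∉ D ∧ t' ∉ D ∧ R t y ∧ R t x ∧ R t' y ∧ R t' x ∧ R i t' := by
  classical
  have hin : ∀ a, S a z → a = y := fun a ha => by
    rcases hS a z ha with h | h | h
    · exact (h.2.2 hz).elim
    · exact h.1
    · exact (hx (h.2 ▸ hz)).elim
  have hout : ∀ a, S z a → a = x := fun a ha => by
    rcases hS z a ha with h | h | h
    · exact (h.2.1 hz).elim
    · exact (hy (h.1 ▸ hz)).elim
    · exact h.2
  have hdel : ∀ a b, a ≠ z → b ≠ z → S a b → del R D a b := fun a b ha hb hab => by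
    rcases hS a b hab with h | h | h
    · exact h
    · exact (hb h.2).elim
    · exact (ha h.1).elim
  obtain ⟨h0, h1, h2, h3, h4, h5, h6, h7⟩ := h.arcs
  have n0 : X 0 ≠ z := fun e => h.ne23 ((hout _ (e ▸ h0)).trans (hout _ (e ▸ h1)).symm)
  have n1 : X 1 ≠ z := fun e => h.ne23 ((hout _ (e ▸ h2)).trans (hout _ (e ▸ h3)).symm)
  have n2 : X 2 ≠ z := fun e => h.ne01 ((hin _ (e ▸ h0)).trans (hin _ (e ▸ h2)).symm)
  have n3 : X 3 ≠ z := fun e => h.ne01 ((hin _ (e ▸ h1)).trans (hin _ (e ▸ h3)).symm)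
  have k0 := hdel _ _ n0 n2 h0
  have k1 := hdel _ _ n0 n3 h1
  have k2 := hdel _ _ n1 n2 h2
  have k3 := hdel _ _ n1 n3 h3
  by_cases n4 : X 4 = z
  · right
    have e2 : X 2 = x := hout _ (n4 ▸ h4)
    have e3 : X 3 = y := hin _ (n4 ▸ h5)
    have k7 := hdel _ _ (n4 ▸ h.ne64) n1 h7
    exact ⟨X 0, X 1, X 6, h.ne01, k0.2.1, k2.2.1, e3 ▸ k1.1, e2 ▸ k0.1, e3 ▸ k3.1, e2 ▸ k2.1, k7.1⟩
  · left
    have k4 := hdel _ _ n4 n2 h4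
    have k5 := hdel _ _ n3 n4 h5
    obtain ⟨o, ho, o2, o3, o4⟩ : ∃ o, R (X 0) o ∧ o ≠ X 2 ∧ o ≠ X 3 ∧ o ≠ X 4 := by
      by_cases n5 : X 5 = z
      · have : X 0 = y := hin _ (n5 ▸ h6)
        exact ⟨d₁, this ▸ hyd, fun e => k0.2.2 (e ▸ hd₁), fun e => k1.2.2 (e ▸ hd₁),
          fun e => k4.2.1 (e ▸ hd₁)⟩
      · exact ⟨X 5, (hdel _ _ n0 n5 h6).1, h.ne52, h.ne53, h.ne54⟩
    obtain ⟨i, hi, i4⟩ : ∃ i, R i (X 1) ∧ i ≠ X 4 := by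
      by_cases n6 : X 6 = z
      · have : X 1 = x := hout _ (n6 ▸ h7)
        exact ⟨d₂, this ▸ hdx, fun e => k4.2.1 (e ▸ hd₂)⟩
      · exact ⟨X 6, (hdel _ _ n6 n1 h7).1, h.ne64⟩
    exact ⟨![X 0, X 1, X 2, X 3, X 4, o, i],
      .of_arcs k0.1 k1.1 k2.1 k3.1 k4.1 k5.1 ho hi h.ne01 h.ne23 o2 o3 o4 i4⟩

theorem Block.of_path (hz : z ∈ D) (hy : y ∉ D) (hx : x ∉ D) (hd₁ : d₁ ∈ D) (hyd : R y d₁)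
    (hd₂ : d₂ ∈ D) (hdx : R d₂ x)
    (hS : ∀ a b, S a b → del R D a b ∨ (a = y ∧ b = z) ∨ (a = z ∧ b = x)) {X : Fin 6 → V}
    (h : Block S X) : ∃ X', Block R X' := by
  have hin : ∀ a, S a z → a = y := fun a ha => by
    rcases hS a z ha with h | h | h
    · exact (h.2.2 hz).elim
    · exact h.1
    · exact (hx (h.2 ▸ hz)).elim
  have hout : ∀ a, S z a → a = x := fun a ha => by
    rcases hS z a ha with h | h | h
    · exact (h.2.1 hz).elim
    · exact (hy (h.1 ▸ hz)).elim
    · exact h.2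
  have hdel : ∀ a b, a ≠ z → b ≠ z → S a b → del R D a b := fun a b ha hb hab => by
    rcases hS a b hab with h | h | h
    · exact h
    · exact (hb h.2).elim
    · exact (ha h.1).elim
  obtain ⟨h0, h1, h2, h3, h4, h5, h6⟩ := h.arcs
  have n0 : X 0 ≠ z := fun e => h.ne23 ((hout _ (e ▸ h1)).trans (hout _ (e ▸ h2)).symm)
  have n1 : X 1 ≠ z := fun e => h.ne23 ((hin _ (e ▸ h3)).trans (hin _ (e ▸ h4)).symm)
  have n2 : X 2 ≠ z := fun e => h.ne41 ((hout _ (e ▸ h5)).trans (hout _ (e ▸ h3)).symm)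
  have n3 : X 3 ≠ z := fun e => h.ne50 ((hin _ (e ▸ h6)).trans (hin _ (e ▸ h2)).symm)
  have k0 := hdel _ _ n0 n1 h0
  have k1 := hdel _ _ n0 n2 h1
  have k2 := hdel _ _ n0 n3 h2
  have k3 := hdel _ _ n2 n1 h3
  have k4 := hdel _ _ n3 n1 h4
  obtain ⟨o, ho, o1, o3⟩ : ∃ o, R (X 2) o ∧ o ≠ X 1 ∧ o ≠ X 3 := by
    by_cases n4 : X 4 = z
    · have : X 2 = y := hin _ (n4 ▸ h5)
      exact ⟨d₁, this ▸ hyd, fun e => k0.2.2 (e ▸ hd₁), fun e => k2.2.2 (e ▸ hd₁)⟩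
    · exact ⟨X 4, (hdel _ _ n2 n4 h5).1, h.ne41, h.ne43⟩
  obtain ⟨i, hi, i0⟩ : ∃ i, R i (X 3) ∧ i ≠ X 0 := by
    by_cases n5 : X 5 = z
    · have : X 3 = x := hout _ (n5 ▸ h6)
      exact ⟨d₂, this ▸ hdx, fun e => k0.2.1 (e ▸ hd₂)⟩
    · exact ⟨X 5, (hdel _ _ n5 n3 h6).1, h.ne50⟩
  exact ⟨![X 0, X 1, X 2, X 3, o, i], .of_arcs k0.1 k1.1 k2.1 k3.1 k4.1 ho hi h.ne23 o1 o3 i0⟩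

/-- Two boundary vertices `y`, `x` of a deleted set `D` can be given different colours, by colouring
a smaller relation in which `D` is replaced by a path `y → z → x`. This fails only if that path
creates an obstruction, and then `x` and `y` lie on the same side of a directed 4-cycle. -/
theorem Crit.exists_ne_or [Finite V] (h : Crit R) (hy : y ∉ D) (hx : x ∉ D) (hxy : x ≠ y)
    (hd₁ : d₁ ∈ D) (hyd : R y d₁) (hd₂ : d₂ ∈ D) (hdx : R d₂ x) {a b : V} (hab : R a b)
    (habD : a ∈ D ∨ b ∈ D) (hab₁ : (a, b) ≠ (y, d₁)) (hab₂ : (a, b) ≠ (d₂, x)) :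
    (∃ ψ, Proper (del R D) ψ ∧ ψ x ≠ ψ y) ∨
      ∃ t t' i, t ≠ t' ∧ t ∉ D ∧ t' ∉ D ∧
        ((R t y ∧ R t x ∧ R t' y ∧ R t' x ∧ R i t') ∨
          (R y t ∧ R x t ∧ R y t' ∧ R x t' ∧ R t' i)) := by
  classical
  set S : V → V → Prop := fun a b => del R D a b ∨ (a = y ∧ b = d₁) ∨ (a = d₁ ∧ b = x) with hSdef
  have hS : ∀ a b, S a b → del R D a b ∨ (a = y ∧ b = d₁) ∨ (a = d₁ ∧ b = x) := fun a b h => h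
  have hasymm : Asymm S := by
    rintro p q (⟨hpq, hp, hq⟩ | ⟨rfl, rfl⟩ | ⟨rfl, rfl⟩) (⟨hqp, -, hp'⟩ | ⟨e₁, e₂⟩ | ⟨e₁, e₂⟩)
    · exact h.adm.asymm _ _ hpq hqp
    · exact hp (e₂ ▸ hd₁)
    · exact hq (e₁ ▸ hd₁)
    · exact h.adm.asymm _ _ hyd hqp
    · exact hy (e₂ ▸ hd₁)
    · exact hxy e₂.symm
    · exact hp' hd₁
    · exact hxy e₁
    · exact hx (e₁ ▸ hd₁)
  -- The neighbours of a vertex of `S`.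
  have hnz : ∀ q, Nbr S d₁ q → q = y ∨ q = x := by
    rintro q ((⟨-, hp, -⟩ | ⟨e, -⟩ | ⟨-, e⟩) | (⟨-, -, hp⟩ | ⟨e, -⟩ | ⟨-, e⟩))
    · exact (hp hd₁).elim
    · exact (hy (e ▸ hd₁)).elim
    · exact .inr e
    · exact (hp hd₁).elim
    · exact .inl e
    · exact (hx (e ▸ hd₁)).elim
  have hnx : ∀ q, Nbr S x q → q = d₁ ∨ (Nbr R x q ∧ q ∉ D) := by
    rintro q ((⟨hp, -, hq⟩ | ⟨e, -⟩ | ⟨e, -⟩) | (⟨hp, hq, -⟩ | ⟨-, e⟩ | ⟨e, -⟩))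
    · exact .inr ⟨.inl hp, hq⟩
    · exact (hxy e).elim
    · exact (hx (e ▸ hd₁)).elim
    · exact .inr ⟨.inr hp, hq⟩
    · exact (hx (e ▸ hd₁)).elim
    · exact .inl e
  have hno : ∀ p, p ≠ d₁ → p ≠ x → ∀ q, Nbr S p q → Nbr R p q := by
    rintro p hp hpx q ((⟨hq, -, -⟩ | ⟨rfl, rfl⟩ | ⟨e, -⟩) | (⟨hq, -, -⟩ | ⟨-, e⟩ | ⟨-, e⟩))
    · exact .inl hq
    · exact .inl hyd
    · exact (hp e).elim
    · exact .inr hq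
    · exact (hp e).elim
    · exact (hpx e).elim
  have hcubic : Subcubic S := by
    intro p y₁ y₂ y₃ h12 h13 h23 h1 h2 h3 q hq
    by_cases hp : p = d₁
    · subst hp
      rcases hnz _ h1 with rfl | rfl <;> rcases hnz _ h2 with rfl | rfl <;>
        rcases hnz _ h3 with rfl | rfl <;> contradiction
    by_cases hpx : p = x
    · subst hpx
      refine h.adm.cubic.transfer (fun q => if q = d₁ then d₂ else q) ?_ ?_ h12 h13 h23 h1 h2 h3 hq
      · intro q hq
        rcases hnx q hq with rfl | ⟨hq, hqD⟩
        · rw [if_pos rfl]; exact .inr hdx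
        · rwa [if_neg]
          rintro rfl; exact hqD hd₁
      · intro q q' hq hq' e
        rcases hnx q hq with rfl | ⟨hq, hqD⟩ <;> rcases hnx q' hq' with rfl | ⟨hq', hqD'⟩
        · rfl
        · have : q' ≠ q := by rintro rfl; exact hqD' hd₁
          simp only [if_true, this, if_false] at e
          exact (hqD' (e ▸ hd₂)).elim
        · have : q ≠ q' := by rintro rfl; exact hqD hd₁
          simp only [if_true, this, if_false] at e
          exact (hqD (e ▸ hd₂)).elim
        · have h1 : q ≠ d₁ := by rintro rfl; exact hqD hd₁
          have h2 : q' ≠ d₁ := by rintro rfl; exact hqD' hd₁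
          simpa [h1, h2] using e
    · exact h.adm.cubic.transfer id (hno p hp hpx) (fun _ _ _ _ e => e) h12 h13 h23 h1 h2 h3 hq
  have hlow : LowComponents S := by
    intro X hX hcl
    by_contra! hall
    have hz : d₁ ∉ X := fun hz => by
      obtain ⟨y₁, y₂, y₃, h12, h13, h23, h1, h2, h3⟩ := hall _ hz
      rcases hnz _ h1 with rfl | rfl <;> rcases hnz _ h2 with rfl | rfl <;>
        rcases hnz _ h3 with rfl | rfl <;> contradiction
    obtain ⟨p, hp, q, hq, hq'⟩ := h.adm.low.exists_new h.adm.cubic hX hcl hall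
    refine hq' (hno p (fun e => hz (e ▸ hp)) (fun e => hz ?_) q hq)
    exact hcl p hp _ (.inr (.inr (.inr ⟨rfl, e⟩)))
  by_cases hcol : ∃ ψ, Proper S ψ
  · obtain ⟨ψ, hψ⟩ := hcol
    refine .inl ⟨ψ, hψ.mono fun a b hab => .inl hab, fun e => ?_⟩
    have e₁ := hψ y d₁ (.inr (.inl ⟨rfl, rfl⟩))
    have e₂ := hψ d₁ x (.inr (.inr ⟨rfl, rfl⟩))
    rw [e] at e₂
    have : ∀ c d, adj c d = true → adj d c = true → False := by decide
    exact this _ _ e₁ e₂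
  right
  have hlt : numArcs S < numArcs R := by
    refine numArcs_lt_of_three (e₁ := (y, d₁)) (e₂ := (d₂, x)) (e₃ := (a, b)) (g₁ := (y, d₁))
      (g₂ := (d₁, x)) (fun e => hy ((Prod.mk.inj e).1 ▸ hd₂)) hab₁.symm hab₂.symm hyd hdx
      hab ?_
    rintro ⟨p, q⟩ (⟨hpq, hp, hq⟩ | ⟨rfl, rfl⟩ | ⟨rfl, rfl⟩)
    · refine .inr (.inr ⟨hpq, ?_, ?_, ?_⟩)
      · rintro ⟨⟩; exact hq hd₁
      · rintro ⟨⟩; exact hp hd₂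
      · rintro ⟨⟩; exact habD.elim hp hq
    · exact .inl rfl
    · exact .inr (.inl rfl)
  have hadm : ¬ Adm S := fun hadm => hcol (h.ih S hadm hlt)
  by_contra hK
  refine hadm ⟨hasymm, hcubic, hlow, fun X hX => ?_, fun X hX => ?_, fun X hX => ?_⟩
  · rcases hX.of_path hd₁ hy hx hd₁ hyd hd₂ hdx hS with ⟨X', hX'⟩ | ⟨t, t', i, h0, h1, h2, h3⟩
    · exact h.adm.noObs _ hX'
    · exact hK ⟨t, t', i, h0, h1, h2, .inl h3⟩
  · have hS' : ∀ a b, _root_.flip S a b →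
        del (_root_.flip R) D a b ∨ (a = x ∧ b = d₁) ∨ (a = d₁ ∧ b = y) := by
      rintro a b (⟨h1, h2, h3⟩ | ⟨h1, h2⟩ | ⟨h1, h2⟩)
      · exact .inl ⟨h1, h3, h2⟩
      · exact .inr (.inr ⟨h2, h1⟩)
      · exact .inr (.inl ⟨h2, h1⟩)
    rcases hX.of_path (R := _root_.flip R) hd₁ hx hy hd₂ hdx hd₁ hyd hS' with
      ⟨X', hX'⟩ | ⟨t, t', i, h0, h1, h2, h3, h4, h5, h6, h7⟩
    · exact h.adm.noObs' _ hX'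
    · exact hK ⟨t, t', i, h0, h1, h2, .inr ⟨h4, h3, h6, h5, h7⟩⟩
  · obtain ⟨X', hX'⟩ := hX.of_path hd₁ hy hx hd₁ hyd hd₂ hdx hS
    exact h.adm.noBlock _ hX'

end Path

/-- Of two boundary vertices `x₁`, `x₂` entered from a deleted set `D`, at least one can be given a
colour different from that of a boundary vertex `y` with an arc into `D`. -/
theorem Crit.exists_ne_or_ne [Finite V] {R : V → V → Prop} {D : Set V} {x₁ x₂ y d d₁ d₂ : V}
    (h : Crit R) (hy : y ∉ D) (hx₁ : x₁ ∉ D) (hx₂ : x₂ ∉ D) (hd : d ∈ D) (hyd : R y d)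
    (hd₁ : d₁ ∈ D) (hdx₁ : R d₁ x₁) (hd₂ : d₂ ∈ D) (hdx₂ : R d₂ x₂) (hne : x₁ = x₂ → d₁ ≠ d₂)
    (hxy : ¬ (x₁ = y ∧ x₂ = y)) :
    ∃ ψ, Proper (del R D) ψ ∧ ¬ (ψ x₁ = ψ y ∧ ψ x₂ = ψ y) := by
  have hasymm := h.adm.asymm
  have hcubic := h.adm.cubic
  have a12 : (d₁, x₁) ≠ (d₂, x₂) := fun e => hne (congrArg Prod.snd e) (congrArg Prod.fst e)
  have a1 : (d₁, x₁) ≠ (y, d) := fun e => hy ((Prod.mk.inj e).1 ▸ hd₁)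
  have a2 : (d₂, x₂) ≠ (y, d) := fun e => hy ((Prod.mk.inj e).1 ▸ hd₂)
  by_contra hno
  push Not at hno
  -- If `y` lies on a 4-cycle off `D`, then it has no neighbour in `D` besides `d`.
  have key : ∀ t t', t ≠ t' → t ∉ D → t' ∉ D → Nbr R y t → Nbr R y t' → ∀ q, Nbr R y q →
      q = t ∨ q = t' ∨ q = d := fun t t' htt ht ht' h1 h2 =>
    hcubic y t t' d htt (fun e => ht (e ▸ hd)) (fun e => ht' (e ▸ hd)) h1 h2 (.inl hyd)
  have hny : ∀ t t', t ≠ t' → t ∉ D → t' ∉ D → Nbr R y t → Nbr R y t' → ∀ q ∈ D, R q y → False := by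
    intro t t' htt ht ht' h1 h2 q hq hqy
    rcases key t t' htt ht ht' h1 h2 q (.inr hqy) with rfl | rfl | rfl
    · exact ht hq
    · exact ht' hq
    · exact hasymm _ _ hqy hyd
  have K₁ : x₁ ≠ y → ∃ t t' i, t ≠ t' ∧ t ∉ D ∧ t' ∉ D ∧
      ((R t y ∧ R t x₁ ∧ R t' y ∧ R t' x₁ ∧ R i t') ∨
        (R y t ∧ R x₁ t ∧ R y t' ∧ R x₁ t' ∧ R t' i)) := fun hx => by
    refine (h.exists_ne_or hy hx₁ hx hd hyd hd₁ hdx₁ hdx₂ (.inl hd₂) a2 a12.symm).resolve_left ?_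
    rintro ⟨ψ, hψ, hψ'⟩
    exact hψ' (hno ψ hψ).1
  have K₂ : x₂ ≠ y → ∃ t t' i, t ≠ t' ∧ t ∉ D ∧ t' ∉ D ∧
      ((R t y ∧ R t x₂ ∧ R t' y ∧ R t' x₂ ∧ R i t') ∨
        (R y t ∧ R x₂ t ∧ R y t' ∧ R x₂ t' ∧ R t' i)) := fun hx => by
    refine (h.exists_ne_or hy hx₂ hx hd hyd hd₂ hdx₂ hdx₁ (.inl hd₁) a1 a12).resolve_left ?_
    rintro ⟨ψ, hψ, hψ'⟩
    exact hψ' (hno ψ hψ).2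
  have nbrs : ∀ {t x i t' : V}, (R t y ∧ R t x ∧ R t' y ∧ R t' x ∧ R i t') ∨
      (R y t ∧ R x t ∧ R y t' ∧ R x t' ∧ R t' i) →
      Nbr R y t ∧ Nbr R y t' ∧ Nbr R t x ∧ Nbr R t' x := by
    rintro t x i t' (⟨h1, h2, h3, h4, -⟩ | ⟨h1, h2, h3, h4, -⟩)
    · exact ⟨.inr h1, .inr h3, .inl h2, .inl h4⟩
    · exact ⟨.inl h1, .inl h3, .inr h2, .inr h4⟩
  by_cases hx1 : x₁ = y
  · have hx2 : x₂ ≠ y := fun e => hxy ⟨hx1, e⟩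
    obtain ⟨t, t', i, htt, ht, ht', hc⟩ := K₂ hx2
    obtain ⟨n1, n2, -, -⟩ := nbrs hc
    exact hny t t' htt ht ht' n1 n2 d₁ hd₁ (hx1 ▸ hdx₁)
  obtain ⟨t, t', i, htt, ht, ht', hc⟩ := K₁ hx1
  obtain ⟨n1, n2, n3, n4⟩ := nbrs hc
  by_cases hx2 : x₂ = y
  · exact hny t t' htt ht ht' n1 n2 d₂ hd₂ (hx2 ▸ hdx₂)
  obtain ⟨s, s', j, hss, hs, hs', hc'⟩ := K₂ hx2
  obtain ⟨m1, m2, m3, m4⟩ := nbrs hc'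
  have mem : ∀ r, r ∉ D → Nbr R y r → r = t ∨ r = t' := fun r hr hr' => by
    rcases key t t' htt ht ht' n1 n2 r hr' with e | e | e
    · exact .inl e
    · exact .inr e
    · exact (hr (e ▸ hd)).elim
  by_cases hx12 : x₁ = x₂
  · subst hx12
    rcases hcubic x₁ t t' d₁ htt (fun e => ht (e ▸ hd₁)) (fun e => ht' (e ▸ hd₁)) (nbr_comm.1 n3)
      (nbr_comm.1 n4) (.inr hdx₁) d₂ (.inr hdx₂) with e | e | e
    · exact ht (e ▸ hd₂)
    · exact ht' (e ▸ hd₂)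
    · exact hne rfl e.symm
  -- Now `t'` has the neighbours `y`, `x₁`, `x₂`, all in the same direction.
  have hdir : (R y t' → R x₂ t') ∧ (R t' y → R t' x₂) := by
    have : t' = s ∨ t' = s' := by
      rcases mem s hs m1 with e | e <;> rcases mem s' hs' m2 with e' | e'
      · exact (hss (e.trans e'.symm)).elim
      · exact .inr e'.symm
      · exact .inl e.symm
      · exact (hss (e.trans e'.symm)).elim
    rcases hc' with ⟨c1, c2, c3, c4, -⟩ | ⟨c1, c2, c3, c4, -⟩ <;> rcases this with rfl | rfl
    · exact ⟨fun h => (hasymm _ _ h c1).elim, fun _ => c2⟩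
    · exact ⟨fun h => (hasymm _ _ h c3).elim, fun _ => c4⟩
    · exact ⟨fun _ => c2, fun h => (hasymm _ _ h c1).elim⟩
    · exact ⟨fun _ => c4, fun h => (hasymm _ _ h c3).elim⟩
  rcases hc with ⟨-, -, c3, c4, c5⟩ | ⟨-, -, c3, c4, c5⟩
  · have c6 := hdir.2 c3
    rcases hcubic t' y x₁ x₂ (Ne.symm hx1) (Ne.symm hx2) hx12 (.inl c3) (.inl c4) (.inl c6)
      i (.inr c5) with rfl | rfl | rfl
    · exact hasymm _ _ c3 c5
    · exact hasymm _ _ c4 c5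
    · exact hasymm _ _ c6 c5
  · have c6 := hdir.1 c3
    rcases hcubic t' y x₁ x₂ (Ne.symm hx1) (Ne.symm hx2) hx12 (.inr c3) (.inr c4) (.inr c6)
      i (.inl c5) with rfl | rfl | rfl
    · exact hasymm _ _ c3 c5
    · exact hasymm _ _ c4 c5
    · exact hasymm _ _ c6 c5

/-! ### Recolouring an obstruction -/

theorem Asymm.ne {R : V → V → Prop} (h : Asymm R) {x y : V} (hxy : R x y) : x ≠ y :=
  fun e => h x y hxy (e ▸ e ▸ hxy)

section Obs

variable {S : V → V → Prop} {X : Fin 7 → V}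

/-- The five vertices of an obstruction that are recoloured. -/
def Obs.core (X : Fin 7 → V) : Set V := {X 0, X 1, X 2, X 3, X 4}

theorem Obs.ne_of_asymm (hS : Asymm S) (h : Obs S X) :
    (X 0 ≠ X 2 ∧ X 0 ≠ X 3 ∧ X 0 ≠ X 4 ∧ X 1 ≠ X 2 ∧ X 1 ≠ X 3 ∧ X 1 ≠ X 4) ∧
      X 2 ≠ X 4 ∧ X 3 ≠ X 4 ∧ X 5 ≠ X 0 ∧ X 6 ≠ X 1 ∧ X 6 ≠ X 2 ∧ X 6 ≠ X 3 := by
  obtain ⟨h0, h1, h2, h3, h4, h5, h6, h7⟩ := h.arcs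
  exact ⟨⟨hS.ne h0, hS.ne h1, fun e => hS _ _ h5 (e ▸ h1), hS.ne h2, hS.ne h3,
    fun e => hS _ _ h5 (e ▸ h3)⟩, (hS.ne h4).symm, hS.ne h5, (hS.ne h6).symm, hS.ne h7,
    fun e => hS _ _ h7 (e ▸ h2), fun e => hS _ _ h7 (e ▸ h3)⟩

theorem Obs.full (hS : Asymm S) (h : Obs S X) :
    Full S (X 0) ∧ Full S (X 1) ∧ Full S (X 2) ∧ Full S (X 3) := by
  obtain ⟨h0, h1, h2, h3, h4, h5, h6, h7⟩ := h.arcs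
  obtain ⟨⟨n02, n03, n04, n12, n13, n14⟩, n24, n34, n50, n61, n62, n63⟩ := h.ne_of_asymm hS
  exact ⟨⟨X 2, X 3, X 5, h.ne23, h.ne52.symm, h.ne53.symm, .inl h0, .inl h1, .inl h6⟩,
    ⟨X 2, X 3, X 6, h.ne23, n62.symm, n63.symm, .inl h2, .inl h3, .inr h7⟩,
    ⟨X 0, X 1, X 4, h.ne01, n04, n14, .inr h0, .inr h2, .inr h4⟩,
    ⟨X 0, X 1, X 4, h.ne01, n04, n14, .inr h1, .inr h3, .inl h5⟩⟩

theorem Obs.nbrs (hS : Asymm S) (hd : Subcubic S) (h : Obs S X) :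
    (∀ y, Nbr S (X 0) y → y = X 2 ∨ y = X 3 ∨ y = X 5) ∧
    (∀ y, Nbr S (X 1) y → y = X 2 ∨ y = X 3 ∨ y = X 6) ∧
    (∀ y, Nbr S (X 2) y → y = X 0 ∨ y = X 1 ∨ y = X 4) ∧
    (∀ y, Nbr S (X 3) y → y = X 0 ∨ y = X 1 ∨ y = X 4) := by
  obtain ⟨h0, h1, h2, h3, h4, h5, h6, h7⟩ := h.arcs
  obtain ⟨⟨n02, n03, n04, n12, n13, n14⟩, n24, n34, n50, n61, n62, n63⟩ := h.ne_of_asymm hS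
  exact ⟨hd _ _ _ _ h.ne23 h.ne52.symm h.ne53.symm (.inl h0) (.inl h1) (.inl h6),
    hd _ _ _ _ h.ne23 n62.symm n63.symm (.inl h2) (.inl h3) (.inr h7),
    hd _ _ _ _ h.ne01 n04 n14 (.inr h0) (.inr h2) (.inr h4),
    hd _ _ _ _ h.ne01 n04 n14 (.inr h1) (.inr h3) (.inl h5)⟩

theorem Obs.diamond_iff (hS : Asymm S) (hd : Subcubic S) (h : Obs S X) : X 5 = X 1 ↔ X 6 = X 0 := by
  obtain ⟨h0, h1, h2, h3, h4, h5, h6, h7⟩ := h.arcs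
  obtain ⟨⟨n02, n03, n04, n12, n13, n14⟩, n24, n34, n50, n61, n62, n63⟩ := h.ne_of_asymm hS
  obtain ⟨b0, b1, -, -⟩ := h.nbrs hS hd
  constructor
  · intro e
    rcases b1 (X 0) (.inr (e ▸ h6)) with e | e | e
    · exact (n02 e).elim
    · exact (n03 e).elim
    · exact e.symm
  · intro e
    rcases b0 (X 1) (.inl (e ▸ h7)) with e | e | e
    · exact (n12 e).elim
    · exact (n13 e).elim
    · exact e.symm

/-- The only arcs at the core of an obstruction are its own arcs and the third edge at the apex. -/
theorem Obs.arc_cases (hS : Asymm S) (hd : Subcubic S) (h : Obs S X) {x y : V} (hxy : S x y)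
    (hmem : x ∈ Obs.core X ∨ y ∈ Obs.core X) :
    (∃ k, x = X (src k) ∧ y = X (tgt k)) ∨ (x = X 4 ∧ y ∉ Obs.core X) ∨
      (y = X 4 ∧ x ∉ Obs.core X) := by
  obtain ⟨h0, h1, h2, h3, h4, h5, h6, h7⟩ := h.arcs
  obtain ⟨b0, b1, b2, b3⟩ := h.nbrs hS hd
  by_cases hx0 : x = X 0
  · subst hx0
    rcases b0 y (.inl hxy) with rfl | rfl | rfl
    exacts [.inl ⟨0, rfl, rfl⟩, .inl ⟨1, rfl, rfl⟩, .inl ⟨6, rfl, rfl⟩]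
  by_cases hx1 : x = X 1
  · subst hx1
    rcases b1 y (.inl hxy) with rfl | rfl | rfl
    exacts [.inl ⟨2, rfl, rfl⟩, .inl ⟨3, rfl, rfl⟩, (hS _ _ hxy h7).elim]
  by_cases hx2 : x = X 2
  · subst hx2
    rcases b2 y (.inl hxy) with rfl | rfl | rfl
    exacts [(hS _ _ hxy h0).elim, (hS _ _ hxy h2).elim, (hS _ _ hxy h4).elim]
  by_cases hx3 : x = X 3
  · subst hx3
    rcases b3 y (.inl hxy) with rfl | rfl | rfl
    exacts [(hS _ _ hxy h1).elim, (hS _ _ hxy h3).elim, .inl ⟨5, rfl, rfl⟩]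
  by_cases hy0 : y = X 0
  · subst hy0
    rcases b0 x (.inr hxy) with rfl | rfl | rfl
    exacts [(hx2 rfl).elim, (hx3 rfl).elim, (hS _ _ hxy h6).elim]
  by_cases hy1 : y = X 1
  · subst hy1
    rcases b1 x (.inr hxy) with rfl | rfl | rfl
    exacts [(hx2 rfl).elim, (hx3 rfl).elim, .inl ⟨7, rfl, rfl⟩]
  by_cases hy2 : y = X 2
  · subst hy2
    rcases b2 x (.inr hxy) with rfl | rfl | rfl
    exacts [(hx0 rfl).elim, (hx1 rfl).elim, .inl ⟨4, rfl, rfl⟩]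
  by_cases hy3 : y = X 3
  · subst hy3
    rcases b3 x (.inr hxy) with rfl | rfl | rfl
    exacts [(hx0 rfl).elim, (hx1 rfl).elim, (hS _ _ hxy h5).elim]
  simp only [Obs.core, Set.mem_insert_iff, Set.mem_singleton_iff, hx0, hx1, hx2, hx3, hy0, hy1, hy2,
    hy3, false_or] at hmem ⊢
  rcases hmem with rfl | rfl
  · exact .inr (.inl ⟨rfl, (hS.ne hxy).symm⟩)
  · exact .inr (.inr ⟨rfl, hS.ne hxy⟩)

/-- Extension of a colouring from the complement of the core of an obstruction, up to the arc `k`.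
The second alternative for the colours `c` of the obstruction is the case `o = T₂`, `i = T₁`. -/
theorem Obs.exists_extend (hS : Asymm S) (hd : Subcubic S) (h : Obs S X) (k : Fin 8)
    (ψ₀ : V → Fin 7)
    (hψ₀ : ∀ x y, S x y → x ∉ Obs.core X → y ∉ Obs.core X → adj (ψ₀ x) (ψ₀ y) = true)
    (c : Fin 7 → Fin 7)
    (hc : (X 5 ≠ X 1 ∧ c 5 = ψ₀ (X 5) ∧ c 6 = ψ₀ (X 6) ∧
        ∀ j, j = k ∨ adj (c (src j)) (c (tgt j)) = true) ∨
      (X 5 = X 1 ∧ c 5 = c 1 ∧ c 6 = c 0 ∧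
        ∀ j, j = k ∨ (6 ≤ j ∧ 6 ≤ k) ∨ adj (c (src j)) (c (tgt j)) = true))
    (hp : ∀ q, q ≠ X 2 → q ≠ X 3 → (S (X 4) q → adj (c 4) (ψ₀ q) = true) ∧
      (S q (X 4) → adj (ψ₀ q) (c 4) = true)) :
    ∃ ψ : V → Fin 7, (∀ j, ψ (X j) = c j) ∧ (∀ x, x ∉ Obs.core X → ψ x = ψ₀ x) ∧
      ∀ x y, S x y → ¬ (x = X (src k) ∧ y = X (tgt k)) → adj (ψ x) (ψ y) = true := by
  classical
  obtain ⟨⟨n02, n03, n04, n12, n13, n14⟩, n24, n34, n50, n61, n62, n63⟩ := h.ne_of_asymm hS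
  set ψ : V → Fin 7 := fun x => if x = X 0 then c 0 else if x = X 1 then c 1 else
    if x = X 2 then c 2 else if x = X 3 then c 3 else if x = X 4 then c 4 else ψ₀ x with hψ
  have hoff : ∀ x, x ∉ Obs.core X → ψ x = ψ₀ x := by
    intro x hx
    simp only [Obs.core, Set.mem_insert_iff, Set.mem_singleton_iff, not_or] at hx
    simp [hψ, hx.1, hx.2.1, hx.2.2.1, hx.2.2.2.1, hx.2.2.2.2]
  have e0 : ψ (X 0) = c 0 := by simp [hψ]
  have e1 : ψ (X 1) = c 1 := by simp [hψ, h.ne01.symm]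
  have e2 : ψ (X 2) = c 2 := by simp [hψ, n02.symm, n12.symm]
  have e3 : ψ (X 3) = c 3 := by simp [hψ, n03.symm, n13.symm, h.ne23.symm]
  have e4 : ψ (X 4) = c 4 := by simp [hψ, n04.symm, n14.symm, n24.symm, n34.symm]
  have e56 : ψ (X 5) = c 5 ∧ ψ (X 6) = c 6 := by
    rcases hc with ⟨hne, h5, h6, -⟩ | ⟨he, h5, h6, -⟩
    · have hne' : X 6 ≠ X 0 := fun e => hne ((h.diamond_iff hS hd).2 e)
      rw [h5, h6]
      exact ⟨hoff _ (by simp [Obs.core, n50, hne, h.ne52, h.ne53, h.ne54]),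
        hoff _ (by simp [Obs.core, n61, hne', n62, n63, h.ne64])⟩
    · rw [h5, h6, he, (h.diamond_iff hS hd).1 he]
      exact ⟨e1, e0⟩
  have hcol : ∀ j, ψ (X j) = c j := by
    simp only [Fin.forall_fin_succ, IsEmpty.forall_iff, and_true]
    exact ⟨e0, e1, e2, e3, e4, e56⟩
  refine ⟨ψ, hcol, hoff, fun x y hxy hne => ?_⟩
  by_cases hmem : x ∈ Obs.core X ∨ y ∈ Obs.core X
  · rcases h.arc_cases hS hd hxy hmem with ⟨j, rfl, rfl⟩ | ⟨rfl, hy⟩ | ⟨rfl, hx⟩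
    · rw [hcol, hcol]
      have hjk : j ≠ k := by rintro rfl; exact hne ⟨rfl, rfl⟩
      rcases hc with ⟨-, -, -, hc⟩ | ⟨he, -, -, hc⟩
      · exact (hc j).resolve_left hjk
      · refine ((hc j).resolve_left hjk).resolve_left fun hjk' => hne ?_
        have he' := (h.diamond_iff hS hd).1 he
        have : ∀ j : Fin 8, 6 ≤ j → j = 6 ∨ j = 7 := by decide
        rcases this j hjk'.1 with rfl | rfl <;> rcases this k hjk'.2 with rfl | rfl
        · exact ⟨rfl, rfl⟩
        · exact ⟨he'.symm, he⟩
        · exact ⟨he', he.symm⟩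
        · exact ⟨rfl, rfl⟩
    · rw [e4, hoff y hy]
      exact (hp y (fun e => hy (by simp [Obs.core, e])) (fun e => hy (by simp [Obs.core, e]))).1 hxy
    · rw [e4, hoff x hx]
      exact (hp x (fun e => hx (by simp [Obs.core, e])) (fun e => hx (by simp [Obs.core, e]))).2 hxy
  · rw [not_or] at hmem
    rw [hoff x hmem.1, hoff y hmem.2]
    exact hψ₀ x y hxy hmem.1 hmem.2

/-- An obstruction minus its arc `k` can be coloured, for any colouring of the rest that is not
exceptional, so that the condition of the kind `κ` holds for the ends of the arc and `e`. -/
theorem Obs.exists_ok (hS : Asymm S) (hd : Subcubic S) (h : Obs S X) (κ : Kind) (k : Fin 8) {e : V}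
    (he : ¬ Full S e) (hes : e ≠ X (src k)) (het : e ≠ X (tgt k))
    (hv : κ.valid k true ∨ κ.valid k false)
    (hv' : ∀ q, q ≠ X 2 → q ≠ X 3 → (S (X 4) q → κ.valid k true) ∧ (S q (X 4) → κ.valid k false))
    (hdia : κ = .through → X 5 = X 1 → k ≠ 6 ∧ k ≠ 7)
    (ψ₀ : V → Fin 7)
    (hψ₀ : ∀ x y, S x y → x ∉ Obs.core X → y ∉ Obs.core X → adj (ψ₀ x) (ψ₀ y) = true)
    (hexc : X 5 ≠ X 1 → ∀ q, q ≠ X 2 → q ≠ X 3 → ∀ σ : Bool, (σ = true → S (X 4) q) →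
      (σ = false → S q (X 4)) →
      κ.exceptional k σ (ψ₀ (X 6) - ψ₀ (X 5)) (ψ₀ q - ψ₀ (X 5)) (ψ₀ e - ψ₀ (X 5)) = false) :
    ∃ ψ : V → Fin 7, (∀ x y, S x y → ¬ (x = X (src k) ∧ y = X (tgt k)) → adj (ψ x) (ψ y) = true) ∧
      κ.ok (ψ (X (src k))) (ψ (X (tgt k))) (ψ e) = true := by
  obtain ⟨h0, h1, h2, h3, h4, h5, h6, h7⟩ := h.arcs
  obtain ⟨f0, f1, f2, f3⟩ := h.full hS
  have hecore : e ≠ X 4 → e ∉ Obs.core X := by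
    intro h4 hmem
    simp only [Obs.core, Set.mem_insert_iff, Set.mem_singleton_iff] at hmem
    rcases hmem with rfl | rfl | rfl | rfl | rfl
    exacts [he f0, he f1, he f2, he f3, h4 rfl]
  have hthird := hd.third h.ne23 (.inl h4 : Nbr S (X 4) (X 2)) (.inr h5 : Nbr S (X 4) (X 3))
  by_cases he4 : e = X 4
  · -- The apex has no further neighbour, and its colour is the one to be compared.
    subst he4
    have hp : ∀ q, q ≠ X 2 → q ≠ X 3 → ¬ Nbr S (X 4) q := fun q h2 h3 hq =>
      he ⟨X 2, X 3, q, h.ne23, h2.symm, h3.symm, .inl h4, .inr h5, hq⟩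
    have hk4 : k ≠ 4 := by rintro rfl; exact hes rfl
    have hk5 : k ≠ 5 := by rintro rfl; exact het rfl
    have hv2 : (κ.valid k true || κ.valid k false) = true := by simpa using hv
    by_cases hX : X 5 = X 1
    · obtain ⟨c, c5, c6, hc, -, hQ⟩ := exists_of_searchDiamond (searchDiamond_apex κ k hv2
        (fun hκ => hdia hκ hX) hk4 hk5)
      obtain ⟨ψ, hψ, -, hψ'⟩ := h.exists_extend hS hd k ψ₀ hψ₀ c (.inr ⟨hX, c5, c6, hc⟩)
        fun q h2 h3 =>
          ⟨fun hq => (hp q h2 h3 (.inl hq)).elim, fun hq => (hp q h2 h3 (.inr hq)).elim⟩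
      exact ⟨ψ, hψ', by rwa [hψ, hψ, hψ]⟩
    · obtain ⟨c, c5, c6, hc, -, hQ⟩ := exists_of_search (search_apex κ k hv2 hk4 hk5
        (ψ₀ (X 6) - ψ₀ (X 5)))
      obtain ⟨ψ, hψ, -, hψ'⟩ := h.exists_extend hS hd k ψ₀ hψ₀ (fun j => c j + ψ₀ (X 5))
        (.inl ⟨hX, by simp [c5], by simp [c6], fun j => by simpa [adj_add] using hc j⟩)
        fun q h2 h3 =>
          ⟨fun hq => (hp q h2 h3 (.inl hq)).elim, fun hq => (hp q h2 h3 (.inr hq)).elim⟩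
      exact ⟨ψ, hψ', by rw [hψ, hψ, hψ, Kind.ok_add]; exact hQ⟩
  · have he4' := hecore he4
    -- The third edge at the apex, or a harmless substitute for it.
    obtain ⟨σ, d, hσ, hex, hrel⟩ : ∃ (σ : Bool) (d : Fin 7), κ.valid k σ = true ∧
        (X 5 ≠ X 1 → κ.exceptional k σ (ψ₀ (X 6) - ψ₀ (X 5)) (d - ψ₀ (X 5))
          (ψ₀ e - ψ₀ (X 5)) = false) ∧
        ∀ z, rel σ z d = true → ∀ q, q ≠ X 2 → q ≠ X 3 →
          (S (X 4) q → adj z (ψ₀ q) = true) ∧ (S q (X 4) → adj (ψ₀ q) z = true) := by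
      rcases hthird with hnone | ⟨q, hq2, hq3, hq, hall⟩
      · obtain ⟨σ, hσ⟩ : ∃ σ, κ.valid k σ = true := hv.elim (fun h => ⟨_, h⟩) fun h => ⟨_, h⟩
        refine ⟨σ, ψ₀ (X 5) + 1, hσ, fun _ => ?_, fun z _ q h2 h3 => ?_⟩
        · have : ψ₀ (X 5) + 1 - ψ₀ (X 5) = 1 := by simp
          rw [this]
          cases κ <;> simp [Kind.exceptional]
        · have : ¬ Nbr S (X 4) q := fun hq => (hnone q hq).elim h2 h3
          exact ⟨fun hq => (this (.inl hq)).elim, fun hq => (this (.inr hq)).elim⟩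
      · obtain ⟨σ, ht, hf, hr⟩ := exists_rel hS hq
        refine ⟨σ, ψ₀ q, ?_, fun hX => hexc hX q hq2 hq3 σ ht hf, fun z hz r h2 h3 => ?_⟩
        · cases σ
          · exact (hv' q hq2 hq3).2 (hf rfl)
          · exact (hv' q hq2 hq3).1 (ht rfl)
        · have hrq : Nbr S (X 4) r → r = q := fun hr =>
            ((hall r hr).resolve_left h2).resolve_left h3
          exact ⟨fun h => by have := hrq (.inl h); subst this; exact (hr z _ hz).1 h,
            fun h => by have := hrq (.inr h); subst this; exact (hr z _ hz).2 h⟩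
    by_cases hX : X 5 = X 1
    · obtain ⟨c, c5, c6, hc, hL, hQ⟩ := exists_of_searchDiamond (searchDiamond_boundary κ k σ hσ
        (fun hκ => hdia hκ hX) d (ψ₀ e))
      obtain ⟨ψ, hψ, hoff, hψ'⟩ := h.exists_extend hS hd k ψ₀ hψ₀ c (.inr ⟨hX, c5, c6, hc⟩)
        (hrel _ hL)
      exact ⟨ψ, hψ', by rwa [hψ, hψ, hoff e he4']⟩
    · have hb := search_boundary κ k σ
      simp only [hσ, Bool.not_true, Bool.false_or, allColor_iff] at hb
      have hb' := hb (ψ₀ (X 6) - ψ₀ (X 5)) (d - ψ₀ (X 5)) (ψ₀ e - ψ₀ (X 5))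
      rw [hex hX, Bool.false_or] at hb'
      obtain ⟨c, c5, c6, hc, hL, hQ⟩ := exists_of_search hb'
      obtain ⟨ψ, hψ, hoff, hψ'⟩ := h.exists_extend hS hd k ψ₀ hψ₀ (fun j => c j + ψ₀ (X 5))
        (.inl ⟨hX, by simp [c5], by simp [c6], fun j => by simpa [adj_add] using hc j⟩)
        (hrel _ (by rw [← rel_add σ _ _ (ψ₀ (X 5))] at hL; simpa using hL))
      refine ⟨ψ, hψ', ?_⟩
      rw [← Kind.ok_add κ _ _ _ (ψ₀ (X 5))] at hQ
      rw [hψ, hψ, hoff e he4']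
      simpa using hQ

end Obs

/-! ### Recolouring a block -/

section Block

variable {S : V → V → Prop} {X : Fin 6 → V}

/-- The four vertices of a block that are recoloured. -/
def Block.core (X : Fin 6 → V) : Set V := {X 0, X 1, X 2, X 3}

theorem Block.ne_of_asymm (hS : Asymm S) (hd : Subcubic S) (h : Block S X) :
    (X 0 ≠ X 1 ∧ X 0 ≠ X 2 ∧ X 0 ≠ X 3 ∧ X 1 ≠ X 2 ∧ X 1 ≠ X 3) ∧
      X 4 ≠ X 0 ∧ X 4 ≠ X 2 ∧ X 5 ≠ X 1 ∧ X 5 ≠ X 2 ∧ X 5 ≠ X 3 := by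
  obtain ⟨h0, h1, h2, h3, h4, h5, h6⟩ := h.arcs
  exact ⟨⟨hS.ne h0, hS.ne h1, hS.ne h2, (hS.ne h3).symm, (hS.ne h4).symm⟩,
    fun e => hS _ _ h5 (e ▸ h1), (hS.ne h5).symm, fun e => hS _ _ h6 (e ▸ h4),
    (h.flip hS hd).ne43, hS.ne h6⟩

theorem Block.full (hS : Asymm S) (hd : Subcubic S) (h : Block S X) :
    Full S (X 0) ∧ Full S (X 1) ∧ Full S (X 2) ∧ Full S (X 3) := by
  obtain ⟨h0, h1, h2, h3, h4, h5, h6⟩ := h.arcs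
  obtain ⟨⟨n01, n02, n03, n12, n13⟩, n40, n42, n51, n52, n53⟩ := h.ne_of_asymm hS hd
  exact ⟨⟨X 1, X 2, X 3, n12, n13, h.ne23, .inl h0, .inl h1, .inl h2⟩,
    ⟨X 0, X 2, X 3, n02, n03, h.ne23, .inr h0, .inr h3, .inr h4⟩,
    ⟨X 0, X 1, X 4, n01, n40.symm, h.ne41.symm, .inr h1, .inl h3, .inl h5⟩,
    ⟨X 0, X 1, X 5, n01, h.ne50.symm, n51.symm, .inr h2, .inl h4, .inr h6⟩⟩

theorem Block.arc_cases (hS : Asymm S) (hd : Subcubic S) (h : Block S X) {x y : V} (hxy : S x y)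
    (hmem : x ∈ Block.core X ∨ y ∈ Block.core X) : ∃ k, x = X (bsrc k) ∧ y = X (btgt k) := by
  obtain ⟨h0, h1, h2, h3, h4, h5, h6⟩ := h.arcs
  obtain ⟨⟨n01, n02, n03, n12, n13⟩, n40, n42, n51, n52, n53⟩ := h.ne_of_asymm hS hd
  have b0 := hd _ _ _ _ n12 n13 h.ne23 (.inl h0 : Nbr S (X 0) (X 1)) (.inl h1) (.inl h2)
  have b1 := hd _ _ _ _ n02 n03 h.ne23 (.inr h0 : Nbr S (X 1) (X 0)) (.inr h3) (.inr h4)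
  have b2 := hd _ _ _ _ n01 n40.symm h.ne41.symm (.inr h1 : Nbr S (X 2) (X 0)) (.inl h3) (.inl h5)
  have b3 := hd _ _ _ _ n01 h.ne50.symm n51.symm (.inr h2 : Nbr S (X 3) (X 0)) (.inl h4) (.inr h6)
  simp only [Block.core, Set.mem_insert_iff, Set.mem_singleton_iff] at hmem
  rcases hmem with (rfl | rfl | rfl | rfl) | (rfl | rfl | rfl | rfl)
  · rcases b0 y (.inl hxy) with rfl | rfl | rfl
    exacts [⟨0, rfl, rfl⟩, ⟨1, rfl, rfl⟩, ⟨2, rfl, rfl⟩]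
  · rcases b1 y (.inl hxy) with rfl | rfl | rfl
    exacts [(hS _ _ hxy h0).elim, (hS _ _ hxy h3).elim, (hS _ _ hxy h4).elim]
  · rcases b2 y (.inl hxy) with rfl | rfl | rfl
    exacts [(hS _ _ hxy h1).elim, ⟨3, rfl, rfl⟩, ⟨5, rfl, rfl⟩]
  · rcases b3 y (.inl hxy) with rfl | rfl | rfl
    exacts [(hS _ _ hxy h2).elim, ⟨4, rfl, rfl⟩, (hS _ _ hxy h6).elim]
  · rcases b0 x (.inr hxy) with rfl | rfl | rfl
    exacts [(hS _ _ hxy h0).elim, (hS _ _ hxy h1).elim, (hS _ _ hxy h2).elim]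
  · rcases b1 x (.inr hxy) with rfl | rfl | rfl
    exacts [⟨0, rfl, rfl⟩, ⟨3, rfl, rfl⟩, ⟨4, rfl, rfl⟩]
  · rcases b2 x (.inr hxy) with rfl | rfl | rfl
    exacts [⟨1, rfl, rfl⟩, (hS _ _ hxy h3).elim, (hS _ _ hxy h5).elim]
  · rcases b3 x (.inr hxy) with rfl | rfl | rfl
    exacts [⟨2, rfl, rfl⟩, (hS _ _ hxy h4).elim, ⟨6, rfl, rfl⟩]

/-- A block minus its arc `k` can be coloured for any colouring of the rest so that the condition of
the kind `κ` holds for the ends of the arc and `e`. -/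
theorem Block.exists_ok (hS : Asymm S) (hd : Subcubic S) (h : Block S X) (κ : Kind) (k : Fin 7)
    {e : V} (he : ¬ Full S e) (ψ₀ : V → Fin 7)
    (hψ₀ : ∀ x y, S x y → x ∉ Block.core X → y ∉ Block.core X → adj (ψ₀ x) (ψ₀ y) = true) :
    ∃ ψ : V → Fin 7,
      (∀ x y, S x y → ¬ (x = X (bsrc k) ∧ y = X (btgt k)) → adj (ψ x) (ψ y) = true) ∧
      κ.ok (ψ (X (bsrc k))) (ψ (X (btgt k))) (ψ e) = true := by
  classical
  obtain ⟨⟨n01, n02, n03, n12, n13⟩, n40, n42, n51, n52, n53⟩ := h.ne_of_asymm hS hd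
  obtain ⟨f0, f1, f2, f3⟩ := h.full hS hd
  obtain ⟨c, c4, c5, hc, hQ⟩ := exists_of_searchBlock (searchBlock_boundary κ k
    (ψ₀ (X 5) - ψ₀ (X 4)) (ψ₀ e - ψ₀ (X 4)))
  set z := ψ₀ (X 4) with hz
  set ψ : V → Fin 7 := fun x => if x = X 0 then c 0 + z else if x = X 1 then c 1 + z else
    if x = X 2 then c 2 + z else if x = X 3 then c 3 + z else ψ₀ x with hψ
  have hoff : ∀ x, x ∉ Block.core X → ψ x = ψ₀ x := by
    intro x hx
    simp only [Block.core, Set.mem_insert_iff, Set.mem_singleton_iff, not_or] at hx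
    simp [hψ, hx.1, hx.2.1, hx.2.2.1, hx.2.2.2]
  have he' : e ∉ Block.core X := by
    intro hmem
    simp only [Block.core, Set.mem_insert_iff, Set.mem_singleton_iff] at hmem
    rcases hmem with rfl | rfl | rfl | rfl
    exacts [he f0, he f1, he f2, he f3]
  have hcol : ∀ j, ψ (X j) = c j + z := by
    simp only [Fin.forall_fin_succ, IsEmpty.forall_iff, and_true]
    refine ⟨?_, ?_, ?_, ?_, ?_, ?_⟩
    · simp [hψ]
    · change ψ (X 1) = c 1 + z
      simp [hψ, n01.symm]
    · change ψ (X 2) = c 2 + z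
      simp [hψ, n02.symm, n12.symm]
    · change ψ (X 3) = c 3 + z
      simp [hψ, n03.symm, n13.symm, h.ne23.symm]
    · change ψ (X 4) = c 4 + z
      rw [hoff _ (by simp [Block.core, n40, h.ne41, n42, h.ne43]), c4, zero_add]
    · change ψ (X 5) = c 5 + z
      rw [hoff _ (by simp [Block.core, h.ne50, n51, n52, n53]), c5, sub_add_cancel]
  refine ⟨ψ, fun x y hxy hne => ?_, ?_⟩
  · by_cases hmem : x ∈ Block.core X ∨ y ∈ Block.core X
    · obtain ⟨j, rfl, rfl⟩ := h.arc_cases hS hd hxy hmem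
      rw [hcol, hcol, adj_add]
      exact (hc j).resolve_left fun e => hne (e ▸ ⟨rfl, rfl⟩)
    · rw [not_or] at hmem
      rw [hoff x hmem.1, hoff y hmem.2]
      exact hψ₀ x y hxy hmem.1 hmem.2
  · rw [← Kind.ok_add κ _ _ _ z] at hQ
    rw [hcol, hcol, hoff e he']
    simpa using hQ

end Block

/-! ### Replacing a path by an arc -/

theorem adj_asymm : ∀ c d, adj c d = true → adj d c = false := by decide

/-- The kind of the reversed situation. -/
def Kind.flip : Kind → Kind
  | .through => .through
  | .out => .into
  | .into => .out

theorem Kind.ok_flip (κ : Kind) (s t e : Fin 7) : κ.flip.ok (-t) (-s) (-e) = κ.ok s t e := by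
  cases κ <;> simp [Kind.ok, Kind.flip, adj_neg, Bool.beq_eq_decide_eq, Bool.or_comm]

theorem Kind.ok_of_adj {κ : Kind} {s t e : Fin 7} (h : adj s t = true) : κ.ok s t e = true := by
  cases κ <;> simp [Kind.ok, h, adj_asymm _ _ h]

/-- Deletion of `u`, `v` and addition of the arc `s → t`. -/
def repl (R : V → V → Prop) (u v s t : V) (a b : V) : Prop := del R {u, v} a b ∨ (a = s ∧ b = t)

/-- The situation in which the adjacent vertices `u`, `v` are deleted and the arc `s → t` is added.
According to the kind, `u` has neighbours `t → u → s` and `v`, or out-neighbours `s`, `e` and the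
neighbour `v`, or in-neighbours `t`, `e` and the neighbour `v`. The vertices `s`, `t`, `e` each lose
a neighbour. In the last two kinds, the vertex whose colour `u` has to avoid, which is `t` or `s`,
does not have both an in- and an out-neighbour off `u`, `v`. -/
structure Gadget (R : V → V → Prop) (κ : Kind) (u v s t e : V) : Prop where
  crit : Crit R
  adj_uv : Nbr R u v
  su : s ≠ u
  sv : s ≠ v
  tu : t ≠ u
  tv : t ≠ v
  eu : e ≠ u
  ev : e ≠ v
  st : s ≠ t
  es : e ≠ s
  et : e ≠ t
  nts : ¬ R t s
  ns : Nbr R s u ∨ Nbr R s v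
  nt : Nbr R t u ∨ Nbr R t v
  ne : Nbr R e u ∨ Nbr R e v
  through : κ = .through → R t u ∧ R u s
  out : κ = .out → R u s ∧ R u e
  into : κ = .into → R t u ∧ R e u
  mix_out : κ = .out → ∀ c d, c ≠ u → c ≠ v → d ≠ u → d ≠ v → R c t → R t d → False
  mix_into : κ = .into → ∀ c d, c ≠ u → c ≠ v → d ≠ u → d ≠ v → R c s → R s d → False

section Gadget

variable {R : V → V → Prop} {κ : Kind} {u v s t e : V}

theorem Gadget.flip (g : Gadget R κ u v s t e) : Gadget (flip R) κ.flip u v t s e where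
  crit := g.crit.flip
  adj_uv := nbr_flip.2 g.adj_uv
  su := g.tu
  sv := g.tv
  tu := g.su
  tv := g.sv
  eu := g.eu
  ev := g.ev
  st := g.st.symm
  es := g.et
  et := g.es
  nts := g.nts
  ns := by simpa only [nbr_flip] using g.nt
  nt := by simpa only [nbr_flip] using g.ns
  ne := by simpa only [nbr_flip] using g.ne
  through := fun h => by
    have := g.through (by cases κ <;> simp_all [Kind.flip])
    exact ⟨this.2, this.1⟩
  out := fun h => g.into (by cases κ <;> simp_all [Kind.flip])
  into := fun h => g.out (by cases κ <;> simp_all [Kind.flip])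
  mix_out := fun h c d h1 h2 h3 h4 hc hd =>
    g.mix_into (by cases κ <;> simp_all [Kind.flip]) d c h3 h4 h1 h2 hd hc
  mix_into := fun h c d h1 h2 h3 h4 hc hd =>
    g.mix_out (by cases κ <;> simp_all [Kind.flip]) d c h3 h4 h1 h2 hd hc

theorem repl_flip {a b : V} :
    repl (_root_.flip R) u v t s a b ↔ _root_.flip (repl R u v s t) a b := by
  unfold repl del _root_.flip
  constructor
  · rintro (⟨h1, h2, h3⟩ | ⟨h1, h2⟩)
    exacts [.inl ⟨h1, h3, h2⟩, .inr ⟨h2, h1⟩]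
  · rintro (⟨h1, h2, h3⟩ | ⟨h1, h2⟩)
    exacts [.inl ⟨h1, h3, h2⟩, .inr ⟨h2, h1⟩]

theorem mem_uv {a : V} : a ∉ ({u, v} : Set V) ↔ a ≠ u ∧ a ≠ v := by simp

theorem Gadget.asymm (g : Gadget R κ u v s t e) : Asymm (repl R u v s t) := by
  rintro a b (⟨hab, -, -⟩ | ⟨rfl, rfl⟩) (⟨hba, -, -⟩ | ⟨e₁, e₂⟩)
  · exact g.crit.adm.asymm _ _ hab hba
  · exact g.nts (by rwa [← e₁, ← e₂])
  · exact g.nts hba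
  · exact g.st e₂

theorem Gadget.off (g : Gadget R κ u v s t e) {a b : V} (h : Nbr (repl R u v s t) a b) :
    (a ≠ u ∧ a ≠ v) ∧ (b ≠ u ∧ b ≠ v) := by
  rcases h with (⟨-, h1, h2⟩ | ⟨rfl, rfl⟩) | (⟨-, h2, h1⟩ | ⟨rfl, rfl⟩)
  · exact ⟨mem_uv.1 h1, mem_uv.1 h2⟩
  · exact ⟨⟨g.su, g.sv⟩, g.tu, g.tv⟩
  · exact ⟨mem_uv.1 h1, mem_uv.1 h2⟩
  · exact ⟨⟨g.tu, g.tv⟩, g.su, g.sv⟩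

theorem Gadget.nbr_repl (g : Gadget R κ u v s t e) {a b : V} (h : Nbr (repl R u v s t) a b) :
    Nbr R a b ∨ (a = s ∧ b = t) ∨ (a = t ∧ b = s) := by
  rcases h with (⟨h, -, -⟩ | ⟨rfl, rfl⟩) | (⟨h, -, -⟩ | ⟨rfl, rfl⟩)
  · exact .inl (.inl h)
  · exact .inr (.inl ⟨rfl, rfl⟩)
  · exact .inl (.inr h)
  · exact .inr (.inr ⟨rfl, rfl⟩)

theorem exists_mem_uv {a : V} (h : Nbr R a u ∨ Nbr R a v) : ∃ d, (d = u ∨ d = v) ∧ Nbr R a d :=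
  h.elim (fun h => ⟨u, .inl rfl, h⟩) fun h => ⟨v, .inr rfl, h⟩

theorem Gadget.subcubic (g : Gadget R κ u v s t e) : Subcubic (repl R u v s t) := by
  classical
  intro x y₁ y₂ y₃ h12 h13 h23 h1 h2 h3 y hy
  -- At `s` and `t`, the new neighbour replaces a deleted one.
  have aux : ∀ r d, (d = u ∨ d = v) → Nbr R x d →
      (∀ b, Nbr (repl R u v s t) x b → Nbr R x b ∨ b = r) →
      y = y₁ ∨ y = y₂ ∨ y = y₃ := by
    intro r d hd hxd hr
    refine g.crit.adm.cubic.transfer (fun b => if b = r then d else b) ?_ ?_ h12 h13 h23 h1 h2 h3 hy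
    · intro b hb
      by_cases hbr : b = r
      · simpa [hbr] using hxd
      · simpa [hbr] using (hr b hb).resolve_right hbr
    · intro b b' hb hb' e
      have hbd : ∀ b, Nbr (repl R u v s t) x b → b ≠ d := fun b hb hbd => by
        obtain ⟨-, h1, h2⟩ := g.off hb
        rcases hd with rfl | rfl
        exacts [h1 hbd, h2 hbd]
      by_cases h1 : b = r <;> by_cases h2 : b' = r
      · exact h1.trans h2.symm
      · simp only [h1, h2, if_true, if_false] at e
        exact (hbd _ hb' e.symm).elim
      · simp only [h1, h2, if_true, if_false] at e
        exact (hbd _ hb e).elim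
      · simpa [h1, h2] using e
  by_cases hxs : x = s
  · obtain ⟨d, hd, hxd⟩ := exists_mem_uv g.ns
    subst hxs
    refine aux t d hd hxd fun b hb => ?_
    rcases g.nbr_repl hb with h | h | h
    exacts [.inl h, .inr h.2, (g.st h.1).elim]
  by_cases hxt : x = t
  · obtain ⟨d, hd, hxd⟩ := exists_mem_uv g.nt
    subst hxt
    refine aux s d hd hxd fun b hb => ?_
    rcases g.nbr_repl hb with h | h | h
    exacts [.inl h, (hxs h.1).elim, .inr h.2]
  refine g.crit.adm.cubic.transfer id (fun b hb => ?_) (fun _ _ _ _ e => e) h12 h13 h23 h1 h2 h3 hy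
  rcases g.nbr_repl hb with h | h | h
  exacts [h, (hxs h.1).elim, (hxt h.1).elim]

/-- The third vertex loses a neighbour and gains none. -/
theorem Gadget.not_full (g : Gadget R κ u v s t e) : ¬ Full (repl R u v s t) e := by
  rintro ⟨y₁, y₂, y₃, h12, h13, h23, h1, h2, h3⟩
  have hn : ∀ y, Nbr (repl R u v s t) e y → Nbr R e y := fun y hy => by
    rcases g.nbr_repl hy with h | h | h
    exacts [h, (g.es h.1).elim, (g.et h.1).elim]
  obtain ⟨d, hd, hed⟩ := exists_mem_uv g.ne
  have hyd : ∀ y, Nbr (repl R u v s t) e y → d ≠ y := fun y hy hdy => by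
    obtain ⟨-, h1, h2⟩ := g.off hy
    rcases hd with rfl | rfl
    exacts [h1 hdy.symm, h2 hdy.symm]
  rcases g.crit.adm.cubic e y₁ y₂ y₃ h12 h13 h23 (hn _ h1) (hn _ h2) (hn _ h3) d hed with h | h | h
  exacts [hyd _ h1 h, hyd _ h2 h, hyd _ h3 h]

theorem Gadget.numArcs_lt [Finite V] (g : Gadget R κ u v s t e) :
    numArcs (repl R u v s t) < numArcs R := by
  have key : ∀ y₁ y₂ y₃, y₁ ≠ y₂ → y₁ ≠ y₃ → y₂ ≠ y₃ → Nbr R u y₁ → Nbr R u y₂ → Nbr R u y₃ →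
      numArcs (repl R u v s t) < numArcs R := by
    intro y₁ y₂ y₃ h12 h13 h23 h1 h2 h3
    have arc : ∀ y, Nbr R u y → ∃ e : V × V, R e.1 e.2 ∧ (e = (u, y) ∨ e = (y, u)) := fun y hy =>
      hy.elim (fun h => ⟨(u, y), h, .inl rfl⟩) fun h => ⟨(y, u), h, .inr rfl⟩
    have hirr : ∀ y, Nbr R u y → y ≠ u := fun y hy hyu => by
      subst hyu
      exact hy.elim (fun h => g.crit.adm.asymm _ _ h h) fun h => g.crit.adm.asymm _ _ h h
    have hne : ∀ {y y'} {e e' : V × V}, y ≠ y' → Nbr R u y → Nbr R u y' →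
        (e = (u, y) ∨ e = (y, u)) → (e' = (u, y') ∨ e' = (y', u)) → e ≠ e' := by
      intro y y' e e' hyy hy hy' he he' hee
      have n1 := hirr _ hy
      have n2 := hirr _ hy'
      rcases he with rfl | rfl <;> rcases he' with rfl | rfl <;> simp_all
    obtain ⟨e₁, r1, c1⟩ := arc _ h1
    obtain ⟨e₂, r2, c2⟩ := arc _ h2
    obtain ⟨e₃, r3, c3⟩ := arc _ h3
    refine numArcs_lt_of_three (g₁ := (s, t)) (g₂ := (s, t)) (hne h12 h1 h2 c1 c2)
      (hne h13 h1 h3 c1 c3) (hne h23 h2 h3 c2 c3) r1 r2 r3 ?_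
    rintro ⟨a, b⟩ (⟨hab, ha, hb⟩ | ⟨rfl, rfl⟩)
    · have ha := (mem_uv.1 ha).1
      have hb := (mem_uv.1 hb).1
      have hn : ∀ {y} {e : V × V}, (e = (u, y) ∨ e = (y, u)) → (a, b) ≠ e := by
        rintro y e (rfl | rfl) h
        · exact ha (Prod.mk.inj h).1
        · exact hb (Prod.mk.inj h).2
      exact .inr (.inr ⟨hab, hn c1, hn c2, hn c3⟩)
    · exact .inl rfl
  cases hκ : κ
  · obtain ⟨h1, h2⟩ := g.through hκ
    exact key t s v g.st.symm g.tv g.sv (.inr h1) (.inl h2) g.adj_uv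
  · obtain ⟨h1, h2⟩ := g.out hκ
    exact key s e v g.es.symm g.sv g.ev (.inl h1) (.inl h2) g.adj_uv
  · obtain ⟨h1, h2⟩ := g.into hκ
    exact key t e v g.et.symm g.tv g.ev (.inr h1) (.inr h2) g.adj_uv

end Gadget

/-! ### Colourings compatible with the removed path -/

theorem del_flip {R : V → V → Prop} {D : Set V} {a b : V} :
    del (_root_.flip R) D a b ↔ _root_.flip (del R D) a b :=
  ⟨fun h => ⟨h.1, h.2.2, h.2.1⟩, fun h => ⟨h.1, h.2.2, h.2.1⟩⟩

theorem Proper.of_del_flip {R : V → V → Prop} {D : Set V} {ψ : V → Fin 7}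
    (h : Proper (del (_root_.flip R) D) ψ) : Proper (del R D) (fun x => -ψ x) :=
  Proper.flip (R := _root_.flip (del R D)) (h.mono fun _ _ => del_flip.2)

section Gadget

variable {R : V → V → Prop} {κ : Kind} {u v s t e : V}

/-- If the new arc creates an obstruction, then the complement of its core has a colouring that is
not exceptional. In an exceptional colouring, three or four boundary vertices have the same colour;
`Crit.exists_ne_or_ne` separates two of them, unless they are all the same vertex. -/
theorem Gadget.exists_boundary [Finite V] (g : Gadget R κ u v s t e) {X : Fin 7 → V}
    (hX : Obs (repl R u v s t) X) (k : Fin 8) (hs : X (src k) = s) (ht : X (tgt k) = t) :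
    ∃ ψ, Proper (del R ({u, v} ∪ Obs.core X)) ψ ∧ (X 5 ≠ X 1 → ∀ q, q ≠ X 2 → q ≠ X 3 →
      ∀ σ : Bool, (σ = true → repl R u v s t (X 4) q) → (σ = false → repl R u v s t q (X 4)) →
      κ.exceptional k σ (ψ (X 6) - ψ (X 5)) (ψ q - ψ (X 5)) (ψ e - ψ (X 5)) = false) := by
  have hS := g.asymm
  have hd := g.subcubic
  obtain ⟨h0, h1, h2, h3, h4, h5, h6, h7⟩ := hX.arcs
  obtain ⟨⟨n02, n03, n04, n12, n13, n14⟩, n24, n34, n50, n61, n62, n63⟩ := hX.ne_of_asymm hS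
  obtain ⟨b0, b1, b2, b3⟩ := hX.nbrs hS hd
  obtain ⟨f0, f1, f2, f3⟩ := hX.full hS
  have hu : u ∈ ({u, v} ∪ Obs.core X : Set V) := by simp
  have hc0 : X 0 ∈ ({u, v} ∪ Obs.core X : Set V) := by simp [Obs.core]
  have hc1 : X 1 ∈ ({u, v} ∪ Obs.core X : Set V) := by simp [Obs.core]
  have hc4 : X 4 ∈ ({u, v} ∪ Obs.core X : Set V) := by simp [Obs.core]
  -- Arcs of the modified relation other than `s → t` are arcs of `R`.
  have hRS : ∀ a b, repl R u v s t a b → (a ≠ s ∨ b ≠ t) → R a b := by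
    rintro a b (h | ⟨rfl, rfl⟩) hne
    · exact h.1
    · exact (hne.elim (· rfl) (· rfl)).elim
  have hnotin : ∀ {a b}, Nbr (repl R u v s t) a b →
      a ≠ X 0 → a ≠ X 1 → a ≠ X 2 → a ≠ X 3 → a ≠ X 4 → a ∉ ({u, v} ∪ Obs.core X : Set V) := by
    intro a b hab a0 a1 a2 a3 a4
    have := (g.off hab).1
    simp [Obs.core, this.1, this.2, a0, a1, a2, a3, a4]
  obtain ⟨ψ', hψ'⟩ := g.crit.exists_proper_del hu g.adj_uv
  by_cases h51 : X 5 = X 1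
  · exact ⟨ψ', hψ', fun h => (h h51).elim⟩
  have h60 : X 6 ≠ X 0 := fun h => h51 ((hX.diamond_iff hS hd).2 h)
  have m5 := hnotin (.inr h6) n50 h51 hX.ne52 hX.ne53 hX.ne54
  have m6 := hnotin (.inl h7) h60 n61 n62 n63 hX.ne64
  have hq : ∀ q, q ≠ X 2 → q ≠ X 3 → Nbr (repl R u v s t) (X 4) q →
      q ∉ ({u, v} ∪ Obs.core X : Set V) ∧
      ∀ q', q' ≠ X 2 → q' ≠ X 3 → Nbr (repl R u v s t) (X 4) q' → q' = q := by
    intro q q2 q3 hq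
    refine ⟨hnotin (nbr_comm.1 hq) ?_ ?_ q2 q3 ?_, fun q' q2' q3' hq' => ?_⟩
    · rintro rfl
      rcases b0 _ (nbr_comm.1 hq) with h | h | h
      exacts [n24 h.symm, n34 h.symm, hX.ne54 h.symm]
    · rintro rfl
      rcases b1 _ (nbr_comm.1 hq) with h | h | h
      exacts [n24 h.symm, n34 h.symm, hX.ne64 h.symm]
    · rintro rfl
      exact hq.elim (fun h => hS _ _ h h) fun h => hS _ _ h h
    · exact ((hd _ _ _ _ hX.ne23 q2.symm q3.symm (.inl h4) (.inr h5) hq _ hq').resolve_left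
        q2').resolve_left q3'
  -- Three boundary vertices that coincide have all their neighbours in the core.
  have hin : ∀ q, Nbr (repl R u v s t) (X 4) q → X 5 = X 6 → q = X 6 →
      Full (repl R u v s t) (X 6) ∧
        ((R (X 0) (X 5) ∧ R (X 6) (X 1) ∧ Nbr R (X 4) q) → ∀ t, Nbr R (X 6) t →
          t ∈ ({u, v} ∪ Obs.core X : Set V)) := by
    intro q hq e1 e2
    refine ⟨⟨X 0, X 1, X 4, hX.ne01, n04, n14, .inr (e1 ▸ h6), .inl h7, nbr_comm.1 (e2 ▸ hq)⟩, ?_⟩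
    rintro ⟨r1, r2, r3⟩ t ht
    rcases g.crit.adm.cubic (X 6) _ _ _ hX.ne01 n04 n14 (.inr (e1 ▸ r1)) (.inl r2)
      (nbr_comm.1 (e2 ▸ r3)) t ht with rfl | rfl | rfl
    exacts [hc0, hc1, hc4]
  have me : X 4 = s ∨ X 4 = t → e ∉ ({u, v} ∪ Obs.core X : Set V) := by
    intro h
    have e4 : e ≠ X 4 := h.elim (fun h => h ▸ g.es) (fun h => h ▸ g.et)
    have hne : ∀ j, Full (repl R u v s t) (X j) → e ≠ X j := fun j hj he => g.not_full (he ▸ hj)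
    simp [Obs.core, g.eu, g.ev, hne _ f0, hne _ f1, hne _ f2, hne _ f3, e4]
  cases κ
  · by_cases hcase : k = 3 ∧ ∃ q, q ≠ X 2 ∧ q ≠ X 3 ∧ repl R u v s t (X 4) q
    · obtain ⟨rfl, q, q2, q3, h4q⟩ := hcase
      change X 1 = s at hs
      change X 3 = t at ht
      obtain ⟨mq, hq'⟩ := hq q q2 q3 (.inl h4q)
      have r7 := hRS _ _ h7 (.inl (hs ▸ n61))
      have r6 := hRS _ _ h6 (.inl (hs ▸ hX.ne01))
      have rq := hRS _ _ h4q (.inl (hs ▸ n14.symm))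
      obtain ⟨ψ, hψ, hne⟩ := g.crit.exists_ne_or_ne m6 m5 mq hc1 r7 hc0 r6 hc4 rq (fun _ => n04) (by
        rintro ⟨e1, e2⟩
        exact g.crit.adm.noObs ![X 0, X 4, X 2, X 5, X 1, X 3, X 3] (.of_arcs
          (hRS _ _ h0 (.inl (hs ▸ hX.ne01))) r6 (hRS _ _ h4 (.inl (hs ▸ n14.symm)))
          (by have : q = X 5 := e2.trans e1.symm
              exact this ▸ rq)
          (hRS _ _ h2 (.inr (ht ▸ hX.ne23))) (e1 ▸ r7)
          (hRS _ _ h1 (.inl (hs ▸ hX.ne01))) (hRS _ _ h5 (.inl (hs ▸ n13.symm)))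
          n04 hX.ne52.symm hX.ne23.symm hX.ne53.symm n13.symm n13.symm))
      refine ⟨ψ, hψ, fun _ q' q2' q3' σ hσ _ => ?_⟩
      by_contra hex
      simp only [Kind.exceptional, Bool.not_eq_false, Bool.and_eq_true, beq_iff_eq,
        sub_eq_zero] at hex
      obtain ⟨⟨⟨-, hσ'⟩, e1⟩, e2⟩ := hex
      rw [hq' q' q2' q3' (.inl (hσ hσ'))] at e2
      exact hne ⟨e1.symm, e2.trans e1.symm⟩
    · refine ⟨ψ', hψ', fun _ q q2 q3 σ hσ _ => ?_⟩
      by_contra hex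
      simp only [Kind.exceptional, Bool.not_eq_false, Bool.and_eq_true, beq_iff_eq] at hex
      exact hcase ⟨hex.1.1.1, q, q2, q3, hσ hex.1.1.2⟩
  · by_cases hcase : k = 5 ∧ ∃ q, q ≠ X 2 ∧ q ≠ X 3 ∧ repl R u v s t (X 4) q
    · obtain ⟨rfl, q, q2, q3, h4q⟩ := hcase
      change X 3 = s at hs
      change X 4 = t at ht
      obtain ⟨mq, hq'⟩ := hq q q2 q3 (.inl h4q)
      have r7 := hRS _ _ h7 (.inl (hs ▸ n63))
      have r6 := hRS _ _ h6 (.inl (hs ▸ n03))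
      have rq := hRS _ _ h4q (.inl (hs ▸ n34.symm))
      have hcol : ∃ ψ, Proper (del R ({u, v} ∪ Obs.core X)) ψ ∧
          ¬ (ψ (X 6) = ψ (X 5) ∧ ψ q = ψ (X 5) ∧ ψ e = ψ (X 5)) := by
        -- If `o`, `i` and `q` are the same vertex, then `e` is separated from it.
        by_cases hall : X 5 = X 6 ∧ q = X 6
        · obtain ⟨hf, hN⟩ := hin q (.inl h4q) hall.1 hall.2
          rcases g.crit.exists_ne_or m6 (me (.inr ht)) (fun h => g.not_full (h ▸ hf)) hc1 r7 hu
            (g.out rfl).2 r6 (.inl hc0) (fun h => h60 (Prod.mk.inj h).1.symm)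
            (fun h => (g.off (.inl h0)).1.1 (Prod.mk.inj h).1) with
            ⟨ψ, hψ, hne⟩ | ⟨a, a', i, -, ha, -, h⟩
          · exact ⟨ψ, hψ, fun h => hne (h.2.2.trans h.1.symm)⟩
          · exact (ha (hN ⟨r6, r7, .inl rq⟩ a (h.elim (fun h => .inr h.1) fun h => .inl h.1))).elim
        · obtain ⟨ψ, hψ, hne⟩ := g.crit.exists_ne_or_ne m6 m5 mq hc1 r7 hc0 r6 hc4 rq (fun _ => n04)
            hall
          exact ⟨ψ, hψ, fun h => hne ⟨h.1.symm, h.2.1.trans h.1.symm⟩⟩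
      obtain ⟨ψ, hψ, hne⟩ := hcol
      refine ⟨ψ, hψ, fun _ q' q2' q3' σ hσ _ => ?_⟩
      by_contra hex
      simp only [Kind.exceptional, Bool.not_eq_false, Bool.and_eq_true, beq_iff_eq,
        sub_eq_zero] at hex
      obtain ⟨⟨⟨⟨-, hσ'⟩, e1⟩, e2⟩, e3⟩ := hex
      rw [hq' q' q2' q3' (.inl (hσ hσ'))] at e2
      exact hne ⟨e1, e2, e3⟩
    · refine ⟨ψ', hψ', fun _ q q2 q3 σ hσ _ => ?_⟩
      by_contra hex
      simp only [Kind.exceptional, Bool.not_eq_false, Bool.and_eq_true, beq_iff_eq] at hex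
      exact hcase ⟨hex.1.1.1.1, q, q2, q3, hσ hex.1.1.1.2⟩
  · by_cases hcase : k = 4 ∧ ∃ q, q ≠ X 2 ∧ q ≠ X 3 ∧ repl R u v s t q (X 4)
    · obtain ⟨rfl, q, q2, q3, h4q⟩ := hcase
      change X 4 = s at hs
      change X 2 = t at ht
      obtain ⟨mq, hq'⟩ := hq q q2 q3 (.inr h4q)
      have r7 := hRS _ _ h7 (.inl (hs ▸ hX.ne64))
      have r6 := hRS _ _ h6 (.inl (hs ▸ n04))
      have rq := hRS _ _ h4q (.inr (ht ▸ n24.symm))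
      have hcol : ∃ ψ, Proper (del (_root_.flip R) ({u, v} ∪ Obs.core X)) ψ ∧
          ¬ (ψ (X 6) = ψ (X 5) ∧ ψ q = ψ (X 5) ∧ ψ e = ψ (X 5)) := by
        -- If `o`, `i` and `q` are the same vertex, then `e` is separated from it.
        by_cases hall : X 6 = X 5 ∧ q = X 5
        · obtain ⟨hf, hN⟩ := hin q (.inr h4q) hall.1.symm (hall.2.trans hall.1.symm)
          rcases g.crit.flip.exists_ne_or m5 (me (.inl hs))
            (fun h => g.not_full (h ▸ hall.1 ▸ hf)) hc0 r6 hu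
            (g.into rfl).2 r7 (.inl hc1) (fun h => h51 (Prod.mk.inj h).1.symm)
            (fun h => (g.off (.inl h2)).1.1 (Prod.mk.inj h).1) with
            ⟨ψ, hψ, hne⟩ | ⟨a, a', i, -, ha, -, h⟩
          · exact ⟨ψ, hψ, fun h => hne h.2.2⟩
          · refine (ha (hN ⟨r6, r7, .inr rq⟩ a ?_)).elim
            rw [hall.1]
            exact h.elim (fun h => .inl h.1) fun h => .inr h.1
        · obtain ⟨ψ, hψ, hne⟩ := g.crit.flip.exists_ne_or_ne m5 m6 mq hc0 r6 hc1 r7 hc4 rq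
            (fun _ => n14) hall
          exact ⟨ψ, hψ, fun h => hne ⟨h.1, h.2.1⟩⟩
      obtain ⟨ψ, hψ, hne⟩ := hcol
      refine ⟨_, hψ.of_del_flip, fun _ q' q2' q3' σ _ hσ => ?_⟩
      by_contra hex
      simp only [Kind.exceptional, Bool.not_eq_false, Bool.and_eq_true, beq_iff_eq, sub_eq_zero,
        neg_inj, Bool.not_eq_true'] at hex
      obtain ⟨⟨⟨⟨-, hσ'⟩, e1⟩, e2⟩, e3⟩ := hex
      rw [hq' q' q2' q3' (.inr (hσ hσ'))] at e2
      exact hne ⟨e1, e2, e3⟩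
    · refine ⟨ψ', hψ', fun _ q q2 q3 σ _ hσ => ?_⟩
      by_contra hex
      simp only [Kind.exceptional, Bool.not_eq_false, Bool.and_eq_true, beq_iff_eq,
        Bool.not_eq_true'] at hex
      exact hcase ⟨hex.1.1.1.1, q, q2, q3, hσ hex.1.1.1.2⟩

/-- If the new arc creates an obstruction, the obstruction can be recoloured. -/
theorem Gadget.exists_ok_of_obs [Finite V] (g : Gadget R κ u v s t e) {X : Fin 7 → V}
    (hX : Obs (repl R u v s t) X) :
    ∃ ψ, Proper (del R {u, v}) ψ ∧ κ.ok (ψ s) (ψ t) (ψ e) = true := by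
  have hS := g.asymm
  have hd := g.subcubic
  obtain ⟨k, hk⟩ : ∃ k, ¬ R (X (src k)) (X (tgt k)) := by
    by_contra! hall
    exact g.crit.adm.noObs X { hX with arc := hall }
  obtain ⟨hs, ht⟩ := (hX.arc k).resolve_left fun h => hk h.1
  obtain ⟨ψ₀, hψ₀, hexc⟩ := g.exists_boundary hX k hs ht
  obtain ⟨h0, h1, h2, h3, h4, h5, h6, h7⟩ := hX.arcs
  obtain ⟨⟨n02, n03, n04, n12, n13, n14⟩, n24, n34, n50, n61, n62, n63⟩ := hX.ne_of_asymm hS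
  have hRS : ∀ a b, repl R u v s t a b → (a ≠ s ∨ b ≠ t) → R a b := by
    rintro a b (h | ⟨rfl, rfl⟩) hne
    · exact h.1
    · exact (hne.elim (· rfl) (· rfl)).elim
  have hmix : ∀ c d, κ = .out → repl R u v s t c t → repl R u v s t t d → c ≠ s → False :=
    fun c d hκ h1 h2 hcs =>
      g.mix_out hκ c d (g.off (.inl h1)).1.1 (g.off (.inl h1)).1.2 (g.off (.inl h2)).2.1
        (g.off (.inl h2)).2.2 (hRS _ _ h1 (.inl hcs)) (hRS _ _ h2 (.inl g.st.symm))
  have hmix' : ∀ c d, κ = .into → repl R u v s t c s → repl R u v s t s d → d ≠ t → False :=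
    fun c d hκ h1 h2 hdt =>
      g.mix_into hκ c d (g.off (.inl h1)).1.1 (g.off (.inl h1)).1.2 (g.off (.inl h2)).2.1
        (g.off (.inl h2)).2.2 (hRS _ _ h1 (.inr g.st)) (hRS _ _ h2 (.inr hdt))
  -- The position of the new arc in the obstruction is restricted by `mix_out` and `mix_into`.
  have hv : ∀ σ : Bool, (σ = true → κ = .into → k = 4 → False) →
      (σ = false → κ = .out → k = 5 → False) → κ.valid k σ = true := by
    intro σ hi ho
    cases hκ : κ
    · rfl
    · have k1 : k ≠ 1 := by
        rintro rfl
        exact hmix (X 1) (X 4) hκ (ht ▸ h3) (ht ▸ h5) (hs ▸ hX.ne01.symm)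
      have k3 : k ≠ 3 := by
        rintro rfl
        exact hmix (X 0) (X 4) hκ (ht ▸ h1) (ht ▸ h5) (hs ▸ hX.ne01)
      have k5 : k ≠ 5 ∨ σ = true := by
        by_contra! h
        exact ho (by simpa using h.2) hκ h.1
      simp [Kind.valid, k1, k3, k5]
    · have k2 : k ≠ 2 := by
        rintro rfl
        exact hmix' (X 6) (X 3) hκ (hs ▸ h7) (hs ▸ h3) (ht ▸ hX.ne23.symm)
      have k3 : k ≠ 3 := by
        rintro rfl
        exact hmix' (X 6) (X 2) hκ (hs ▸ h7) (hs ▸ h2) (ht ▸ hX.ne23)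
      have k4 : k ≠ 4 ∨ σ = false := by
        by_contra! h
        exact hi (by simpa using h.2) hκ h.1
      simp [Kind.valid, k2, k3, k4]
  suffices h : ∃ ψ : V → Fin 7, (∀ x y, repl R u v s t x y → ¬ (x = X (src k) ∧ y = X (tgt k)) →
      adj (ψ x) (ψ y) = true) ∧ κ.ok (ψ (X (src k))) (ψ (X (tgt k))) (ψ e) = true by
    obtain ⟨ψ, hψ, hok⟩ := h
    refine ⟨ψ, fun x y hxy => hψ x y (.inl hxy) ?_, hs ▸ ht ▸ hok⟩
    rintro ⟨rfl, rfl⟩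
    exact hk hxy.1
  refine hX.exists_ok hS hd κ k (e := e) g.not_full (hs ▸ g.es) (ht ▸ g.et)
    (by
      by_cases hκ : κ = .into
      · exact .inr (hv _ (by simp) (by simp [hκ]))
      · exact .inl (hv _ (by simp [hκ]) (by simp)))
    (fun q q2 q3 => ⟨fun hq => hv _ (fun _ hκ hk => ?_) (by simp),
      fun hq => hv _ (by simp) (fun _ hκ hk => ?_)⟩)
    (fun hκ h51 => ?_) ψ₀ (fun x y hxy hx hy => ?_) hexc
  · subst hk
    exact hmix' (X 3) q hκ (hs ▸ h5) (hs ▸ hq) (ht ▸ q2)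
  · subst hk
    exact hmix q (X 2) hκ (ht ▸ hq) (ht ▸ h4) (hs ▸ q3)
  · -- Otherwise the removed path `T₂ → u → T₁` yields an obstruction of `R`.
    by_contra hk'
    have h60 := (hX.diamond_iff hS hd).1 h51
    have : X 0 = s ∧ X 1 = t := by
      by_cases k6 : k = 6
      · subst k6
        exact ⟨hs, h51.symm.trans ht⟩
      · have k7 : k = 7 := by
          by_contra k7
          exact hk' ⟨k6, k7⟩
        subst k7
        exact ⟨h60.symm.trans hs, ht⟩
    obtain ⟨e0, e1⟩ := this
    have hu := g.through hκ
    rw [← e0, ← e1] at hu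
    have o2 := (g.off (.inl h0)).2.1
    have o3 := (g.off (.inl h1)).2.1
    have o4 := (g.off (.inl h4)).1.1
    exact g.crit.adm.noObs ![X 1, X 0, X 2, X 3, X 4, u, u] (.of_arcs
      (hRS _ _ h2 (.inr (e1 ▸ n12.symm))) (hRS _ _ h3 (.inr (e1 ▸ n13.symm)))
      (hRS _ _ h0 (.inr (e1 ▸ n12.symm))) (hRS _ _ h1 (.inr (e1 ▸ n13.symm)))
      (hRS _ _ h4 (.inr (e1 ▸ n12.symm))) (hRS _ _ h5 (.inr (e1 ▸ n14.symm)))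
      hu.1 hu.2 hX.ne01.symm hX.ne23 o2.symm o3.symm o4.symm o4.symm)
  · rcases hxy with h | ⟨rfl, rfl⟩
    · exact hψ₀ x y ⟨h.1, by simpa [hx] using h.2.1, by simpa [hy] using h.2.2⟩
    · rw [← hs] at hx
      rw [← ht] at hy
      exfalso
      revert hx hy
      have hk : ∀ k, src k = 0 ∨ src k = 1 ∨ src k = 4 ∨ src k = 3 ∨ tgt k = 1 := by decide
      rcases hk k with e | e | e | e | e <;> simp [e, Obs.core]

theorem Gadget.exists_ok_of_block [Finite V] (g : Gadget R κ u v s t e) {X : Fin 6 → V}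
    (hX : Block (repl R u v s t) X) :
    ∃ ψ, Proper (del R {u, v}) ψ ∧ κ.ok (ψ s) (ψ t) (ψ e) = true := by
  obtain ⟨k, hk⟩ : ∃ k, ¬ R (X (bsrc k)) (X (btgt k)) := by
    by_contra! hall
    exact g.crit.adm.noBlock X { hX with arc := hall }
  obtain ⟨rfl, rfl⟩ := (hX.arc k).resolve_left fun h => hk h.1
  have hu : u ∈ ({u, v} ∪ Block.core X : Set V) := by simp
  obtain ⟨ψ₀, hψ₀⟩ := g.crit.exists_proper_del hu g.adj_uv
  obtain ⟨ψ, hψ, hok⟩ := hX.exists_ok g.asymm g.subcubic κ k (e := e) g.not_full ψ₀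
    fun x y hxy hx hy => by
      rcases hxy with h | ⟨rfl, rfl⟩
      · exact hψ₀ x y ⟨h.1, by simpa [hx] using h.2.1, by simpa [hy] using h.2.2⟩
      · exfalso
        have hk : ∀ k, bsrc k = 0 ∨ bsrc k = 2 ∨ bsrc k = 3 ∨ btgt k = 3 := by decide
        revert hx hy
        rcases hk k with e | e | e | e <;> simp [e, Block.core]
  refine ⟨ψ, fun x y hxy => hψ x y (.inl hxy) ?_, hok⟩
  rintro ⟨rfl, rfl⟩
  exact hk hxy.1

/-- The colouring provided by the new arc, or by the obstruction that it creates. -/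
theorem Gadget.exists_ok [Finite V] (g : Gadget R κ u v s t e)
    (hlow : LowComponents (repl R u v s t)) :
    ∃ ψ, Proper (del R {u, v}) ψ ∧ κ.ok (ψ s) (ψ t) (ψ e) = true := by
  by_cases hO : ∃ X, Obs (repl R u v s t) X
  · exact g.exists_ok_of_obs hO.choose_spec
  by_cases hO' : ∃ X, Obs (_root_.flip (repl R u v s t)) X
  · obtain ⟨X, hX⟩ := hO'
    obtain ⟨ψ, hψ, hok⟩ := g.flip.exists_ok_of_obs (X := X)
      { hX with arc := fun k => repl_flip.2 (hX.arc k) }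
    refine ⟨_, hψ.of_del_flip, ?_⟩
    rw [← Kind.ok_flip]
    simpa using hok
  by_cases hB : ∃ X, Block (repl R u v s t) X
  · exact g.exists_ok_of_block hB.choose_spec
  push Not at hO hO' hB
  obtain ⟨ψ, hψ⟩ := g.crit.ih _ ⟨g.asymm, g.subcubic, hlow, hO, hO', hB⟩ g.numArcs_lt
  exact ⟨ψ, hψ.mono fun _ _ h => .inl h, Kind.ok_of_adj (hψ _ _ (.inr ⟨rfl, rfl⟩))⟩

end Gadget

/-! ### Extending a colouring to a deleted vertex -/

/-- A deleted vertex `u` may be put back with the colour `c`. -/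
theorem Proper.update [DecidableEq V] {R : V → V → Prop} {D : Set V} {u : V} {ψ : V → Fin 7}
    {c : Fin 7} (h : Proper (del R (insert u D)) ψ) (hu : ¬ R u u)
    (hc : ∀ y, y ∉ D → y ≠ u → (R u y → adj c (ψ y) = true) ∧ (R y u → adj (ψ y) c = true)) :
    Proper (del R D) (Function.update ψ u c) := by
  rintro x y ⟨hxy, hx, hy⟩
  by_cases hxu : x = u
  · subst hxu
    have hyx : y ≠ x := by rintro rfl; exact hu hxy
    rw [Function.update_self, Function.update_of_ne hyx]
    exact (hc y hy hyx).1 hxy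
  · rw [Function.update_of_ne hxu]
    by_cases hyu : y = u
    · subst hyu
      rw [Function.update_self]
      exact (hc x hx hxu).2 hxy
    · rw [Function.update_of_ne hyu]
      exact h x y ⟨hxy, by simp [hxu, hx], by simp [hyu, hy]⟩

theorem Proper.of_del_empty {R : V → V → Prop} {ψ : V → Fin 7} (h : Proper (del R ∅) ψ) :
    Proper R ψ := fun x y hxy => h x y ⟨hxy, by simp, by simp⟩

theorem Subcubic.third_unique {R : V → V → Prop} (hd : Subcubic R) {x y₁ y₂ q q' : V}
    (h12 : y₁ ≠ y₂) (h1 : Nbr R x y₁) (h2 : Nbr R x y₂) (hq : Nbr R x q) (q1 : q ≠ y₁)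
    (q2 : q ≠ y₂) (hq' : Nbr R x q') (q1' : q' ≠ y₁) (q2' : q' ≠ y₂) : q' = q :=
  ((hd x y₁ y₂ q h12 q1.symm q2.symm h1 h2 hq q' hq').resolve_left q1').resolve_left q2'

theorem Subcubic.exists_third_color {R : V → V → Prop} (hd : Subcubic R) {x y₁ y₂ : V}
    (h12 : y₁ ≠ y₂) (h1 : Nbr R x y₁) (h2 : Nbr R x y₂) (ψ : V → Fin 7) :
    ∃ c, ∀ y, Nbr R x y → y ≠ y₁ → y ≠ y₂ → ψ y = c := by
  by_cases h : ∃ q, Nbr R x q ∧ q ≠ y₁ ∧ q ≠ y₂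
  · obtain ⟨q, hq, q1, q2⟩ := h
    exact ⟨ψ q, fun y hy y1 y2 => by rw [hd.third_unique h12 h1 h2 hq q1 q2 hy y1 y2]⟩
  · exact ⟨0, fun y hy y1 y2 => (h ⟨y, hy, y1, y2⟩).elim⟩

/-! ### Separating the colours of a neighbour of `v` and a third vertex -/

section Gadget

variable {R : V → V → Prop} {κ : Kind} {u v s t e : V}

/-- If the new arc completes a component without a vertex of degree at most two, then this component
contains the ends of the arc, but not the third vertex. -/
theorem Gadget.exists_closed (g : Gadget R κ u v s t e) (h : ¬ LowComponents (repl R u v s t)) :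
    ∃ X, Closed (del R {u, v}) X ∧ s ∈ X ∧ t ∈ X ∧ e ∉ X ∧ u ∉ X := by
  unfold LowComponents at h
  push Not at h
  obtain ⟨X, hne, hX, hfull⟩ := h
  refine ⟨X, fun x hx y hy => hX x hx y (hy.mono fun _ _ h => .inl h), ?_⟩
  have hst : s ∈ X ∧ t ∈ X := by
    obtain ⟨x, hx, y, hy, hxy⟩ := g.crit.adm.low.exists_new g.crit.adm.cubic hne hX hfull
    rcases g.nbr_repl hy with h | ⟨rfl, rfl⟩ | ⟨rfl, rfl⟩
    exacts [(hxy h).elim, ⟨hx, hX _ hx _ hy⟩, ⟨hX _ hx _ hy, hx⟩]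
  refine ⟨hst.1, hst.2, fun he => g.not_full (hfull e he), fun hu => ?_⟩
  obtain ⟨y, -, -, -, -, -, hy, -⟩ := hfull u hu
  exact (g.off hy).1.1 rfl

/-- The path `t → u → s` is replaced by the arc `s → t`, which leaves two colours for `u`. -/
theorem Gadget.exists_ne_of_through [Finite V] (g : Gadget R .through u v s t e) :
    ∃ ψ, Proper (del R {v}) ψ ∧ ψ u ≠ ψ e := by
  classical
  obtain ⟨htu, hus⟩ := g.through rfl
  have hirr : ¬ R u u := fun h => g.crit.adm.asymm _ _ h h
  have hnu := g.crit.adm.cubic u t s v g.st.symm g.tv g.sv (.inr htu) (.inl hus) g.adj_uv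
  by_cases hlow : LowComponents (repl R u v s t)
  · obtain ⟨ψ, hψ, hok⟩ := g.exists_ok hlow
    obtain ⟨c, h1, h2, h3⟩ := Kind.ok_through _ _ _ hok
    refine ⟨Function.update ψ u c, hψ.update hirr fun y hy hyu => ⟨fun h => ?_, fun h => ?_⟩, ?_⟩
    · rcases hnu y (.inl h) with rfl | rfl | rfl
      exacts [(g.crit.adm.asymm _ _ htu h).elim, h2, (hy rfl).elim]
    · rcases hnu y (.inr h) with rfl | rfl | rfl
      exacts [h1, (g.crit.adm.asymm _ _ hus h).elim, (hy rfl).elim]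
    · rwa [Function.update_self, Function.update_of_ne g.eu]
  · obtain ⟨X, hX, hs, ht, he, hu⟩ := g.exists_closed hlow
    obtain ⟨ψ, hψ⟩ := g.crit.exists_proper_del (Set.mem_singleton v) (nbr_comm.1 g.adj_uv)
    by_cases hne : ψ u = ψ e
    · -- `X` and `u` form a union of components off `v`, which may be shifted.
      have hY : Closed (del R {v}) (insert u X) := by
        rintro x (rfl | hx) y hy
        · have hyv : y ≠ v := hy.elim (fun h => h.2.2) fun h => h.2.1
          rcases hnu y (hy.mono fun _ _ h => h.1) with rfl | rfl | rfl
          exacts [.inr ht, .inr hs, (hyv rfl).elim]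
        · by_cases hyu : y = u
          · exact .inl hyu
          · have hxu : x ≠ u := by rintro rfl; exact hu hx
            refine .inr (hX x hx y (hy.imp ?_ ?_))
            · rintro ⟨h1, h2, h3⟩
              exact ⟨h1, mem_uv.2 ⟨hxu, h2⟩, mem_uv.2 ⟨hyu, h3⟩⟩
            · rintro ⟨h1, h2, h3⟩
              exact ⟨h1, mem_uv.2 ⟨hyu, h2⟩, mem_uv.2 ⟨hxu, h3⟩⟩
      refine ⟨_, hψ.shift hY 1, ?_⟩
      have : e ∉ insert u X := by simp [g.eu, he]
      simp [this, hne]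
    · exact ⟨ψ, hψ, hne⟩

/-- The out-neighbour `s` of `u` is joined to `t` by an arc `s → t`, so that the colour of `t` is
not an in-neighbour of that of `s`. -/
theorem Gadget.exists_ne_of_out [Finite V] (g : Gadget R .out u v s t e) :
    ∃ ψ, Proper (del R {v}) ψ ∧ ψ u ≠ ψ t := by
  classical
  obtain ⟨hus, hue⟩ := g.out rfl
  have hirr : ¬ R u u := fun h => g.crit.adm.asymm _ _ h h
  have hnu := g.crit.adm.cubic u s e v g.es.symm g.sv g.ev (.inl hus) (.inl hue) g.adj_uv
  obtain ⟨ψ, hψ, c, h1, h2, h3⟩ : ∃ ψ, Proper (del R {u, v}) ψ ∧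
      ∃ c, adj c (ψ s) = true ∧ adj c (ψ e) = true ∧ c ≠ ψ t := by
    by_cases hlow : LowComponents (repl R u v s t)
    · obtain ⟨ψ, hψ, hok⟩ := g.exists_ok hlow
      exact ⟨ψ, hψ, Kind.ok_out _ _ _ hok⟩
    · obtain ⟨X, hX, hs, ht, he, hu⟩ := g.exists_closed hlow
      obtain ⟨ψ, hψ⟩ := g.crit.exists_proper_del (Set.mem_insert u {v}) g.adj_uv
      -- After a shift of the component of `s`, the vertices `s` and `e` have the same colour.
      refine ⟨_, hψ.shift hX (ψ e - ψ s), ?_⟩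
      obtain ⟨c, h1, h2⟩ := exists_rel_ne true (ψ e) (ψ t + (ψ e - ψ s))
      exact ⟨c, by simpa [hs, rel] using h1, by simpa [he, rel] using h1, by simpa [ht] using h2⟩
  refine ⟨Function.update ψ u c, hψ.update hirr fun y hy hyu => ⟨fun h => ?_, fun h => ?_⟩, ?_⟩
  · rcases hnu y (.inl h) with rfl | rfl | rfl
    exacts [h1, h2, (hy rfl).elim]
  · rcases hnu y (.inr h) with rfl | rfl | rfl
    exacts [(g.crit.adm.asymm _ _ hus h).elim, (g.crit.adm.asymm _ _ hue h).elim, (hy rfl).elim]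
  · rwa [Function.update_self, Function.update_of_ne g.tu]

end Gadget

/-! ### Vertices of degree two -/

/-- A vertex `v` with exactly two neighbours `u`, `w`, which are not adjacent, one of them an
in-neighbour and the other one an out-neighbour. -/
structure Pivot (R : V → V → Prop) (v u w : V) : Prop where
  crit : Crit R
  ne : u ≠ w
  adj_vu : Nbr R v u
  adj_vw : Nbr R v w
  only : ∀ y, Nbr R v y → y = u ∨ y = w
  not_adj : ¬ Nbr R u w
  mixed : (R u v ∧ R v w) ∨ (R w v ∧ R v u)

section Pivot

variable {R : V → V → Prop} {v u w a b : V}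

theorem Pivot.flip (p : Pivot R v u w) : Pivot (flip R) v u w where
  crit := p.crit.flip
  ne := p.ne
  adj_vu := nbr_flip.2 p.adj_vu
  adj_vw := nbr_flip.2 p.adj_vw
  only := by simpa only [nbr_flip] using p.only
  not_adj := by simpa only [nbr_flip] using p.not_adj
  mixed := p.mixed.elim (fun h => .inr ⟨h.2, h.1⟩) fun h => .inl ⟨h.2, h.1⟩

theorem Pivot.symm (p : Pivot R v u w) : Pivot R v w u where
  crit := p.crit
  ne := p.ne.symm
  adj_vu := p.adj_vw
  adj_vw := p.adj_vu
  only := fun y hy => (p.only y hy).symm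
  not_adj := fun h => p.not_adj (nbr_comm.1 h)
  mixed := p.mixed.symm

/-- A path `a → u → b` that is closed by an arc `a → b`. -/
theorem Pivot.exists_ne_of_triangle [Finite V] (p : Pivot R v u w) (hau : R a u) (hub : R u b)
    (hab : R a b) (hav : a ≠ v) (hbv : b ≠ v) : ∃ ψ, Proper (del R {v}) ψ ∧ ψ u ≠ ψ w := by
  classical
  have hR := p.crit.adm.asymm
  have hd := p.crit.adm.cubic
  have hirr : ∀ x, ¬ R x x := fun x h => hR _ _ h h
  have nab := hR.ne hab
  have nau := hR.ne hau
  have nub := hR.ne hub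
  have nwa : w ≠ a := by rintro rfl; exact p.not_adj (.inr hau)
  have nwb : w ≠ b := by rintro rfl; exact p.not_adj (.inl hub)
  have nuv : u ≠ v := by
    rintro rfl
    exact p.adj_vu.elim (hirr _) (hirr _)
  have nwv : w ≠ v := by
    rintro rfl
    exact p.adj_vw.elim (hirr _) (hirr _)
  have nva : ¬ Nbr R a v := fun h => (p.only a (nbr_comm.1 h)).elim nau nwa.symm
  have nvb : ¬ Nbr R b v := fun h => (p.only b (nbr_comm.1 h)).elim nub.symm nwb.symm
  have hua : Nbr R a u := .inl hau
  have hba : Nbr R a b := .inl hab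
  have hub' : Nbr R b u := .inr hub
  have hab' : Nbr R b a := .inr hab
  set D : Set V := {b, a, u, v} with hD
  have hwD : w ∉ D := by simp [hD, nwa, nwb, p.ne.symm, nwv]
  have haD : a ∈ D := by simp [hD]
  have hbD : b ∈ D := by simp [hD]
  have hvD : v ∈ D := by simp [hD]
  -- The exceptional case of the triangle is avoided by a choice of the colouring.
  obtain ⟨ψ, hψ, hexc⟩ : ∃ ψ, Proper (del R D) ψ ∧ ∀ q r, q ≠ u → q ≠ b → R a q → r ≠ u → r ≠ a →
      R r b → ¬ (ψ r = ψ q ∧ ψ w = ψ q) := by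
    by_cases hcase : ∃ q r, q ≠ u ∧ q ≠ b ∧ R a q ∧ r ≠ u ∧ r ≠ a ∧ R r b
    · obtain ⟨q, r, qu, qb, haq, ru, ra, hrb⟩ := hcase
      have hqD : q ∉ D := by
        have h1 : q ≠ v := by rintro rfl; exact nva (.inl haq)
        simp [hD, qb, qu, h1, (hR.ne haq).symm]
      have hrD : r ∉ D := by
        have h1 : r ≠ v := by rintro rfl; exact nvb (.inr hrb)
        simp [hD, ra, ru, h1, hR.ne hrb]
      obtain ⟨ψ, hψ, hne⟩ : ∃ ψ, Proper (del R D) ψ ∧ ¬ (ψ r = ψ q ∧ ψ w = ψ q) := by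
        rcases p.mixed with ⟨huv, hvw⟩ | ⟨hwv, hvu⟩
        · obtain ⟨ψ, hψ, hne⟩ := p.crit.exists_ne_or_ne hrD hqD hwD hbD hrb haD haq hvD hvw
            (fun _ => hav) (by
              rintro ⟨rfl, rfl⟩
              exact p.crit.adm.noBlock ![a, b, u, w, v, v]
                (.of_arcs hab hau haq hub hrb huv hvw p.ne hbv.symm nwv.symm hav.symm))
          exact ⟨ψ, hψ, fun h => hne ⟨h.1.symm, h.2.trans h.1.symm⟩⟩
        · obtain ⟨ψ, hψ, hne⟩ := p.crit.flip.exists_ne_or_ne hqD hrD hwD haD haq hbD hrb hvD hwv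
            (fun _ => hbv) (by
              rintro ⟨rfl, rfl⟩
              exact p.crit.adm.noBlock ![a, b, w, u, v, v]
                (.of_arcs hab haq hau hrb hub hwv hvu p.ne.symm hbv.symm nuv.symm hav.symm))
          exact ⟨_, hψ.of_del_flip, fun h => hne ⟨neg_inj.1 h.1, neg_inj.1 h.2⟩⟩
      refine ⟨ψ, hψ, fun q' r' qu' qb' haq' ru' ra' hrb' => ?_⟩
      rw [hd.third_unique nub hua hba (.inl haq) qu qb (.inl haq') qu' qb',
        hd.third_unique nau.symm hub' hab' (.inr hrb) ru ra (.inr hrb') ru' ra']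
      exact hne
    · obtain ⟨ψ, hψ⟩ := p.crit.exists_proper_del haD (.inl hab)
      exact ⟨ψ, hψ, fun q r h1 h2 h3 h4 h5 h6 => (hcase ⟨q, r, h1, h2, h3, h4, h5, h6⟩).elim⟩
  obtain ⟨c, hc⟩ := hd.exists_third_color nub hua hba ψ
  obtain ⟨d, hd'⟩ := hd.exists_third_color nau.symm hub' hab' ψ
  obtain ⟨σ, hσ, hσ'⟩ : ∃ σ : Bool, (σ = true → ∃ q, q ≠ u ∧ q ≠ b ∧ R a q) ∧
      ∀ z, rel σ z c = true → ∀ q, q ≠ u → q ≠ b →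
        (R a q → adj z (ψ q) = true) ∧ (R q a → adj (ψ q) z = true) := by
    by_cases h : ∃ q, q ≠ u ∧ q ≠ b ∧ R a q
    · refine ⟨true, fun _ => h, fun z hz q qu qb =>
        ⟨fun hq => hc q (.inl hq) qu qb ▸ hz, fun hq => ?_⟩⟩
      obtain ⟨q', qu', qb', hq'⟩ := h
      rw [hd.third_unique nub hua hba (.inl hq') qu' qb' (.inr hq) qu qb] at hq
      exact (hR _ _ hq hq').elim
    · exact ⟨false, by simp, fun z hz q qu qb => ⟨fun hq => (h ⟨q, qu, qb, hq⟩).elim,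
        fun hq => hc q (.inr hq) qu qb ▸ hz⟩⟩
  obtain ⟨τ, hτ, hτ'⟩ : ∃ τ : Bool, (τ = false → ∃ q, q ≠ u ∧ q ≠ a ∧ R q b) ∧
      ∀ z, rel τ z d = true → ∀ q, q ≠ u → q ≠ a →
        (R b q → adj z (ψ q) = true) ∧ (R q b → adj (ψ q) z = true) := by
    by_cases h : ∃ q, q ≠ u ∧ q ≠ a ∧ R q b
    · refine ⟨false, fun _ => h, fun z hz q qu qa =>
        ⟨fun hq => ?_, fun hq => hd' q (.inr hq) qu qa ▸ hz⟩⟩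
      obtain ⟨q', qu', qa', hq'⟩ := h
      rw [hd.third_unique nau.symm hub' hab' (.inr hq') qu' qa' (.inl hq) qu qa] at hq
      exact (hR _ _ hq hq').elim
    · exact ⟨true, by simp, fun z hz q qu qa => ⟨fun hq => hd' q (.inl hq) qu qa ▸ hz,
        fun hq => (h ⟨q, qu, qa, hq⟩).elim⟩⟩
  obtain ⟨ca, hca, cb, hcb, hcab, x, hax, hxb, hxw⟩ := exists_triangle σ τ c d (ψ w) (by
    rintro ⟨e1, e2, e3, e4⟩
    obtain ⟨q, qu, qb, hq⟩ := hσ e1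
    obtain ⟨r, ru, ra, hr⟩ := hτ e2
    refine hexc q r qu qb hq ru ra hr ?_
    rw [hc q (.inl hq) qu qb, hd' r (.inr hr) ru ra]
    exact ⟨e3, e4⟩)
  have hnu := hd u a b v nab hav hbv (.inr hau) (.inl hub) (nbr_comm.1 p.adj_vu)
  have p1 : Proper (del R {a, u, v}) (Function.update ψ b cb) :=
    hψ.update (hirr b) fun y hy hyb => by
      simp only [Set.mem_insert_iff, Set.mem_singleton_iff, not_or] at hy
      exact hτ' cb hcb y hy.2.1 hy.1
  have p2 : Proper (del R {u, v}) (Function.update (Function.update ψ b cb) a ca) :=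
    p1.update (hirr a) fun y hy hya => by
      by_cases hyb : y = b
      · subst hyb
        rw [Function.update_self]
        exact ⟨fun _ => hcab, fun h => (hR _ _ hab h).elim⟩
      · rw [Function.update_of_ne hyb]
        exact hσ' ca hca y (mem_uv.1 hy).1 hyb
  refine ⟨Function.update (Function.update (Function.update ψ b cb) a ca) u x,
    p2.update (hirr u) fun y hy hyu => ⟨fun h => ?_, fun h => ?_⟩, ?_⟩
  · rcases hnu y (.inl h) with rfl | rfl | rfl
    · exact (hR _ _ hau h).elim
    · rwa [Function.update_of_ne nab.symm, Function.update_self]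
    · exact (hy rfl).elim
  · rcases hnu y (.inr h) with rfl | rfl | rfl
    · rwa [Function.update_self]
    · exact (hR _ _ hub h).elim
    · exact (hy rfl).elim
  · rwa [Function.update_self, Function.update_of_ne p.ne.symm, Function.update_of_ne nwa,
      Function.update_of_ne nwb]

/-- The case of a path `a → u → b`. -/
theorem Pivot.exists_ne_of_through [Finite V] (p : Pivot R v u w) (hau : R a u) (hub : R u b)
    (hav : a ≠ v) (hbv : b ≠ v) : ∃ ψ, Proper (del R {v}) ψ ∧ ψ u ≠ ψ w := by
  by_cases hab : R a b
  · exact p.exists_ne_of_triangle hau hub hab hav hbv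
  have hR := p.crit.adm.asymm
  have hirr : ∀ x, ¬ R x x := fun x h => hR _ _ h h
  have g : Gadget R .through u v b a w :=
    { crit := p.crit
      adj_uv := nbr_comm.1 p.adj_vu
      su := (hR.ne hub).symm
      sv := hbv
      tu := hR.ne hau
      tv := hav
      eu := p.ne.symm
      ev := by
        rintro rfl
        exact p.adj_vw.elim (hirr _) (hirr _)
      st := by
        rintro rfl
        exact hR _ _ hau hub
      es := by
        rintro rfl
        exact p.not_adj (.inl hub)
      et := by
        rintro rfl
        exact p.not_adj (.inr hau)
      nts := hab
      ns := .inl (.inr hub)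
      nt := .inl (.inl hau)
      ne := .inr (nbr_comm.1 p.adj_vw)
      through := fun _ => ⟨hau, hub⟩
      out := by simp
      into := by simp
      mix_out := by simp
      mix_into := by simp }
  exact g.exists_ne_of_through

/-- The case of arcs `u → a`, `u → b` without an arc `w → a`, so an arc `a → w` can be added. -/
theorem Pivot.exists_ne_of_not_adj [Finite V] (p : Pivot R v u w) (hua : R u a) (hub : R u b)
    (nab : a ≠ b) (hav : a ≠ v) (hbv : b ≠ v) (hw : ∀ c d, c ≠ v → d ≠ v → R c w → R w d → False)
    (hwa : ¬ R w a) : ∃ ψ, Proper (del R {v}) ψ ∧ ψ u ≠ ψ w := by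
  have hR := p.crit.adm.asymm
  have hirr : ∀ x, ¬ R x x := fun x h => hR _ _ h h
  have g : Gadget R .out u v a w b :=
    { crit := p.crit
      adj_uv := nbr_comm.1 p.adj_vu
      su := (hR.ne hua).symm
      sv := hav
      tu := p.ne.symm
      tv := by
        rintro rfl
        exact p.adj_vw.elim (hirr _) (hirr _)
      eu := (hR.ne hub).symm
      ev := hbv
      st := by
        rintro rfl
        exact p.not_adj (.inl hua)
      es := nab.symm
      et := by
        rintro rfl
        exact p.not_adj (.inl hub)
      nts := hwa
      ns := .inl (.inr hua)
      nt := .inr (nbr_comm.1 p.adj_vw)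
      ne := .inl (.inr hub)
      through := by simp
      out := fun _ => ⟨hua, hub⟩
      into := by simp
      mix_out := fun _ c d _ hc _ hd => hw c d hc hd
      mix_into := by simp }
  exact g.exists_ne_of_out

/-- A 4-cycle directed from `u`, `w` to `a`, `b`. The third edges at `a` and `b` do not have
different directions, because `v` would be the apex of an obstruction; hence `a` and `b` may get
the same colour. -/
theorem Pivot.exists_ne_of_cycle [Finite V] (p : Pivot R v u w) (hua : R u a) (hub : R u b)
    (hwa : R w a) (hwb : R w b) (nab : a ≠ b) (hav : a ≠ v) (hbv : b ≠ v) :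
    ∃ ψ, Proper (del R {v}) ψ ∧ ψ u ≠ ψ w := by
  classical
  have hR := p.crit.adm.asymm
  have hd := p.crit.adm.cubic
  have hirr : ∀ x, ¬ R x x := fun x h => hR _ _ h h
  have nua := hR.ne hua
  have nub := hR.ne hub
  have nwa := hR.ne hwa
  have nwb := hR.ne hwb
  have nuv : u ≠ v := by
    rintro rfl
    exact p.adj_vu.elim (hirr _) (hirr _)
  have nwv : w ≠ v := by
    rintro rfl
    exact p.adj_vw.elim (hirr _) (hirr _)
  have key : ∀ a b, R u a → R u b → R w a → R w b → a ≠ b → ∀ q r, R a q → R r b → r ≠ u → r ≠ w →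
      False := by
    intro a b hua hub hwa hwb nab q r hq hr ru rw
    have hqv : q ≠ v := by
      rintro rfl
      exact (p.only a (.inr hq)).elim (hR.ne hua).symm (hR.ne hwa).symm
    have hrv : r ≠ v := by
      rintro rfl
      exact (p.only b (.inl hr)).elim (hR.ne hub).symm (hR.ne hwb).symm
    rcases p.mixed with ⟨huv, hvw⟩ | ⟨hwv, hvu⟩
    · exact p.crit.adm.noObs' ![b, a, u, w, v, r, q]
        (.of_arcs hub hwb hua hwa huv hvw hr hq nab.symm p.ne ru rw hrv hqv)
    · exact p.crit.adm.noObs' ![b, a, w, u, v, r, q]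
        (.of_arcs hwb hub hwa hua hwv hvu hr hq nab.symm p.ne.symm rw ru hrv hqv)
  have kab := key a b hua hub hwa hwb nab
  have kba := key b a hub hua hwb hwa nab.symm
  have nadj : ¬ Nbr R a b := fun h =>
    h.elim (fun h => kab b a h h nua.symm nwa.symm) fun h => kba a b h h nub.symm nwb.symm
  obtain ⟨ψ, hψ⟩ := p.crit.exists_proper_del (D := {b, a, w, u, v}) (a := v) (by simp) p.adj_vu
  obtain ⟨c, hc⟩ := hd.exists_third_color p.ne (.inr hua) (.inr hwa) ψ
  obtain ⟨d, hd'⟩ := hd.exists_third_color p.ne (.inr hub) (.inr hwb) ψ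
  obtain ⟨z, hza, hzb⟩ : ∃ z, (∀ q, q ≠ u → q ≠ w → (R a q → adj z (ψ q) = true) ∧
        (R q a → adj (ψ q) z = true)) ∧
      ∀ q, q ≠ u → q ≠ w → (R b q → adj z (ψ q) = true) ∧ (R q b → adj (ψ q) z = true) := by
    by_cases h : ∃ q, q ≠ u ∧ q ≠ w ∧ (R q a ∨ R q b)
    · obtain ⟨z, h1, h2⟩ := exists_rel_rel false c d
      obtain ⟨q', qu', qw', hq'⟩ := h
      have ha : ∀ q, q ≠ u → q ≠ w → ¬ R a q := fun q qu qw hq => by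
        rcases hq' with h | h
        · rw [hd.third_unique p.ne (.inr hua) (.inr hwa) (.inr h) qu' qw' (.inl hq) qu qw] at hq
          exact hR _ _ h hq
        · exact kab q q' hq h qu' qw'
      have hb : ∀ q, q ≠ u → q ≠ w → ¬ R b q := fun q qu qw hq => by
        rcases hq' with h | h
        · exact kba q q' hq h qu' qw'
        · rw [hd.third_unique p.ne (.inr hub) (.inr hwb) (.inr h) qu' qw' (.inl hq) qu qw] at hq
          exact hR _ _ h hq
      exact ⟨z, fun q qu qw => ⟨fun hq => (ha q qu qw hq).elim,
          fun hq => hc q (.inr hq) qu qw ▸ h1⟩,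
        fun q qu qw => ⟨fun hq => (hb q qu qw hq).elim, fun hq => hd' q (.inr hq) qu qw ▸ h2⟩⟩
    · obtain ⟨z, h1, h2⟩ := exists_rel_rel true c d
      exact ⟨z, fun q qu qw => ⟨fun hq => hc q (.inl hq) qu qw ▸ h1,
          fun hq => (h ⟨q, qu, qw, .inl hq⟩).elim⟩,
        fun q qu qw => ⟨fun hq => hd' q (.inl hq) qu qw ▸ h2,
          fun hq => (h ⟨q, qu, qw, .inr hq⟩).elim⟩⟩
  obtain ⟨x, hx, -⟩ := exists_rel_ne true z z
  obtain ⟨y, hy, hxy⟩ := exists_rel_ne true z x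
  have hnu := hd u a b v nab hav hbv (.inl hua) (.inl hub) (nbr_comm.1 p.adj_vu)
  have hnw := hd w a b v nab hav hbv (.inl hwa) (.inl hwb) (nbr_comm.1 p.adj_vw)
  have p1 : Proper (del R {a, w, u, v}) (Function.update ψ b z) :=
    hψ.update (hirr b) fun q hq _ => by
      simp only [Set.mem_insert_iff, Set.mem_singleton_iff, not_or] at hq
      exact hzb q hq.2.2.1 hq.2.1
  have p2 : Proper (del R {w, u, v}) (Function.update (Function.update ψ b z) a z) :=
    p1.update (hirr a) fun q hq _ => by
      simp only [Set.mem_insert_iff, Set.mem_singleton_iff, not_or] at hq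
      by_cases hqb : q = b
      · subst hqb
        exact ⟨fun h => (nadj (.inl h)).elim, fun h => (nadj (.inr h)).elim⟩
      · rw [Function.update_of_ne hqb]
        exact hza q hq.2.1 hq.1
  set ψ₂ := Function.update (Function.update ψ b z) a z with hψ₂
  have e1 : ψ₂ a = z := Function.update_self ..
  have e2 : ψ₂ b = z := by rw [hψ₂, Function.update_of_ne nab.symm, Function.update_self]
  have p3 : Proper (del R {u, v}) (Function.update ψ₂ w y) :=
    p2.update (hirr w) fun q hq _ => by
      have hqv := (mem_uv.1 hq).2
      refine ⟨fun h => ?_, fun h => ?_⟩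
      · rcases hnw q (.inl h) with rfl | rfl | rfl
        exacts [e1.symm ▸ hy, e2.symm ▸ hy, (hqv rfl).elim]
      · rcases hnw q (.inr h) with rfl | rfl | rfl
        exacts [(hR _ _ hwa h).elim, (hR _ _ hwb h).elim, (hqv rfl).elim]
  refine ⟨Function.update (Function.update ψ₂ w y) u x, p3.update (hirr u) fun q hq _ =>
    ⟨fun h => ?_, fun h => ?_⟩, ?_⟩
  · rcases hnu q (.inl h) with rfl | rfl | rfl
    · rw [Function.update_of_ne nwa.symm, e1]; exact hx
    · rw [Function.update_of_ne nwb.symm, e2]; exact hx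
    · exact (hq rfl).elim
  · rcases hnu q (.inr h) with rfl | rfl | rfl
    exacts [(hR _ _ hua h).elim, (hR _ _ hub h).elim, (hq rfl).elim]
  · rw [Function.update_self, Function.update_of_ne p.ne.symm, Function.update_self]
    exact hxy.symm

theorem Pivot.exists_ne_of_out [Finite V] (p : Pivot R v u w) (hua : R u a) (hub : R u b)
    (nab : a ≠ b) (hav : a ≠ v) (hbv : b ≠ v)
    (hw : ∀ c d, c ≠ v → d ≠ v → R c w → R w d → False) :
    ∃ ψ, Proper (del R {v}) ψ ∧ ψ u ≠ ψ w := by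
  by_cases hwa : R w a
  · by_cases hwb : R w b
    · exact p.exists_ne_of_cycle hua hub hwa hwb nab hav hbv
    · exact p.exists_ne_of_not_adj hub hua nab.symm hbv hav hw hwb
  · exact p.exists_ne_of_not_adj hua hub nab hav hbv hw hwa

/-- The two neighbours of a pivot can be given different colours. -/
theorem Pivot.exists_ne [Finite V] (p : Pivot R v u w) :
    ∃ ψ, Proper (del R {v}) ψ ∧ ψ u ≠ ψ w := by
  classical
  by_cases hu : ∃ a b, a ≠ v ∧ b ≠ v ∧ R a u ∧ R u b
  · obtain ⟨a, b, hav, hbv, hau, hub⟩ := hu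
    exact p.exists_ne_of_through hau hub hav hbv
  by_cases hw : ∃ a b, a ≠ v ∧ b ≠ v ∧ R a w ∧ R w b
  · obtain ⟨a, b, hav, hbv, haw, hwb⟩ := hw
    obtain ⟨ψ, hψ, hne⟩ := p.symm.exists_ne_of_through haw hwb hav hbv
    exact ⟨ψ, hψ, hne.symm⟩
  by_cases h2 : ∃ a b, a ≠ b ∧ a ≠ v ∧ b ≠ v ∧ Nbr R u a ∧ Nbr R u b
  · obtain ⟨a, b, nab, hav, hbv, hua, hub⟩ := h2
    rcases hua with hua | hua <;> rcases hub with hub | hub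
    · exact p.exists_ne_of_out hua hub nab hav hbv
        fun c d hc hd h1 h2 => hw ⟨c, d, hc, hd, h1, h2⟩
    · exact (hu ⟨b, a, hbv, hav, hub, hua⟩).elim
    · exact (hu ⟨a, b, hav, hbv, hua, hub⟩).elim
    · obtain ⟨ψ, hψ, hne⟩ := p.flip.exists_ne_of_out hua hub nab hav hbv
        fun c d hc hd h1 h2 => hw ⟨d, c, hd, hc, h2, h1⟩
      exact ⟨_, hψ.of_del_flip, fun h => hne (neg_inj.1 h)⟩
  -- Now `u` has at most one neighbour besides `v`, and may be recoloured.
  have hR := p.crit.adm.asymm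
  obtain ⟨ψ, hψ⟩ := p.crit.exists_proper_del (Set.mem_insert u {v}) (nbr_comm.1 p.adj_vu)
  have hirr : ¬ R u u := fun h => hR _ _ h h
  by_cases h1 : ∃ a, a ≠ v ∧ Nbr R u a
  · obtain ⟨a, hav, ha⟩ := h1
    have hall : ∀ y, y ≠ v → Nbr R u y → y = a := fun y hy hy' =>
      by_contra fun h => h2 ⟨y, a, h, hy, hav, hy', ha⟩
    obtain ⟨σ, -, -, hσ⟩ := exists_rel hR ha
    obtain ⟨c, hc, hne⟩ := exists_rel_ne σ (ψ a) (ψ w)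
    refine ⟨Function.update ψ u c, hψ.update hirr fun y hy _ => ⟨fun h => ?_, fun h => ?_⟩, ?_⟩
    · have := hall y hy (.inl h)
      subst this
      exact (hσ _ _ hc).1 h
    · have := hall y hy (.inr h)
      subst this
      exact (hσ _ _ hc).2 h
    · rwa [Function.update_self, Function.update_of_ne p.ne.symm]
  · refine ⟨Function.update ψ u (ψ w + 1), hψ.update hirr fun y hy _ =>
      ⟨fun h => (h1 ⟨y, hy, .inl h⟩).elim, fun h => (h1 ⟨y, hy, .inr h⟩).elim⟩, ?_⟩
    rw [Function.update_self, Function.update_of_ne p.ne.symm]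
    simp

end Pivot

/-- A vertex `v` of degree at most two is removed. Its colour is obstructed only if its two
neighbours have the same colour and `v` is the middle vertex of a directed path between them. -/
theorem Crit.colorable [Finite V] {R : V → V → Prop} (h : Crit R) : ∃ ψ, Proper R ψ := by
  classical
  have hR := h.adm.asymm
  have hirr : ∀ x, ¬ R x x := fun x h => hR _ _ h h
  by_cases hne : ∃ x y, Nbr R x y
  swap
  · exact ⟨fun _ => 0, fun x y hxy => (hne ⟨x, y, .inl hxy⟩).elim⟩
  obtain ⟨v, ⟨u, hu⟩, hv⟩ := h.adm.low {x | ∃ y, Nbr R x y} hne fun x _ y hxy => ⟨x, nbr_comm.1 hxy⟩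
  by_cases h2 : ∃ w, w ≠ u ∧ Nbr R v w
  · obtain ⟨w, hwu, hw⟩ := h2
    have honly : ∀ y, Nbr R v y → y = u ∨ y = w := fun y hy => by
      by_contra! hc
      exact hv ⟨u, w, y, hwu.symm, hc.1.symm, hc.2.symm, hu, hw, hy⟩
    have nuv : u ≠ v := by rintro rfl; exact hu.elim (hirr _) (hirr _)
    have nwv : w ≠ v := by rintro rfl; exact hw.elim (hirr _) (hirr _)
    obtain ⟨σ, hσt, hσf, hσ⟩ := exists_rel hR hu
    obtain ⟨τ, hτt, hτf, hτ⟩ := exists_rel hR hw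
    obtain ⟨ψ, hψ, c, hcu, hcw⟩ : ∃ ψ, Proper (del R {v}) ψ ∧
        ∃ c, rel σ c (ψ u) = true ∧ rel τ c (ψ w) = true := by
      by_cases hστ : σ = τ
      · obtain ⟨ψ, hψ⟩ := h.exists_proper_del (Set.mem_singleton v) hu
        exact ⟨ψ, hψ, hστ ▸ exists_rel_rel σ _ _⟩
      · suffices hne : ∃ ψ, Proper (del R {v}) ψ ∧ ψ u ≠ ψ w by
          obtain ⟨ψ, hψ, hne⟩ := hne
          exact ⟨ψ, hψ, exists_rel_rel_of_ne σ τ _ _ hne⟩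
        by_cases huw : Nbr R u w
        · obtain ⟨ψ, hψ⟩ := h.exists_proper_del (Set.mem_singleton v) hu
          exact ⟨ψ, hψ, hψ.ne (huw.imp (fun h => ⟨h, nuv, nwv⟩) fun h => ⟨h, nwv, nuv⟩)⟩
        · refine Pivot.exists_ne ⟨h, hwu.symm, hu, hw, honly, huw, ?_⟩
          cases σ <;> cases τ
          · exact (hστ rfl).elim
          · exact .inl ⟨hσf rfl, hτt rfl⟩
          · exact .inr ⟨hτf rfl, hσt rfl⟩
          · exact (hστ rfl).elim
    refine ⟨Function.update ψ v c, Proper.of_del_empty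
      (Proper.update (by simpa using hψ) (hirr v) fun y _ _ => ⟨fun hy => ?_, fun hy => ?_⟩)⟩
    · rcases honly y (.inl hy) with rfl | rfl
      exacts [(hσ _ _ hcu).1 hy, (hτ _ _ hcw).1 hy]
    · rcases honly y (.inr hy) with rfl | rfl
      exacts [(hσ _ _ hcu).2 hy, (hτ _ _ hcw).2 hy]
  · have honly : ∀ y, Nbr R v y → y = u := fun y hy => by_contra fun hc => h2 ⟨y, hc, hy⟩
    obtain ⟨σ, -, -, hσ⟩ := exists_rel hR hu
    obtain ⟨ψ, hψ⟩ := h.exists_proper_del (Set.mem_singleton v) hu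
    obtain ⟨c, hc, -⟩ := exists_rel_ne σ (ψ u) 0
    refine ⟨Function.update ψ v c, Proper.of_del_empty
      (Proper.update (by simpa using hψ) (hirr v) fun y _ _ => ⟨fun hy => ?_, fun hy => ?_⟩)⟩
    · have := honly y (.inl hy)
      subst this
      exact (hσ _ _ hc).1 hy
    · have := honly y (.inr hy)
      subst this
      exact (hσ _ _ hc).2 hy

theorem Adm.colorable [Finite V] {R : V → V → Prop} (h : Adm R) : ∃ ψ, Proper R ψ := by
  induction hn : numArcs R using Nat.strong_induction_on generalizing R with
  | _ n ih =>
    subst hn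
    exact Crit.colorable ⟨h, fun S hS hlt => ih _ hlt hS rfl⟩

/-! ### Degrees in oriented graphs -/

section Degree

variable [Finite V] {G : Digraph V} {x y₁ y₂ y₃ : V}

theorem three_le_degree_of_full (h : Full G.Adj x) : 3 ≤ G.degree x := by
  obtain ⟨a, b, c, hab, hac, hbc, ha, hb, hc⟩ := h
  rw [← Set.ncard_eq_three.2 ⟨a, b, c, hab, hac, hbc, rfl⟩]
  refine Set.ncard_le_ncard ?_ (Set.toFinite _)
  rintro y (rfl | rfl | rfl)
  exacts [ha, hb, hc]

theorem subcubic_of_isSubcubic (h : G.IsSubcubic) : Subcubic G.Adj := by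
  intro x a b c hab hac hbc ha hb hc y hy
  have hsub : ({a, b, c} : Set V) ⊆ G.outNeighbors x ∪ G.inNeighbors x := by
    rintro y (rfl | rfl | rfl)
    exacts [ha, hb, hc]
  have heq := Set.eq_of_subset_of_ncard_le hsub
    ((h x).trans (Set.ncard_eq_three.2 ⟨a, b, c, hab, hac, hbc, rfl⟩).ge) (Set.toFinite _)
  have : y ∈ ({a, b, c} : Set V) := heq ▸ hy
  simpa using this

theorem outDegree_eq_three (h : G.IsSubcubic) (h12 : y₁ ≠ y₂) (h13 : y₁ ≠ y₃) (h23 : y₂ ≠ y₃)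
    (h1 : G.Adj x y₁) (h2 : G.Adj x y₂) (h3 : G.Adj x y₃) : G.outDegree x = 3 := by
  refine le_antisymm ((Set.ncard_le_ncard Set.subset_union_left (Set.toFinite _)).trans (h x)) ?_
  rw [← Set.ncard_eq_three.2 ⟨y₁, y₂, y₃, h12, h13, h23, rfl⟩]
  refine Set.ncard_le_ncard ?_ (Set.toFinite _)
  rintro y (rfl | rfl | rfl)
  exacts [h1, h2, h3]

theorem inDegree_eq_three (h : G.IsSubcubic) (h12 : y₁ ≠ y₂) (h13 : y₁ ≠ y₃) (h23 : y₂ ≠ y₃)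
    (h1 : G.Adj y₁ x) (h2 : G.Adj y₂ x) (h3 : G.Adj y₃ x) : G.inDegree x = 3 := by
  refine le_antisymm ((Set.ncard_le_ncard Set.subset_union_right (Set.toFinite _)).trans (h x)) ?_
  rw [← Set.ncard_eq_three.2 ⟨y₁, y₂, y₃, h12, h13, h23, rfl⟩]
  refine Set.ncard_le_ncard ?_ (Set.toFinite _)
  rintro y (rfl | rfl | rfl)
  exacts [h1, h2, h3]

/-- In a subcubic oriented graph, a vertex of out-degree three is a source of degree three. -/
theorem isSource_of_outDegree_eq_three (hor : G.IsOriented) (h : G.IsSubcubic)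
    (hx : G.outDegree x = 3) : G.degree x = 3 ∧ G.IsSource x := by
  have hle : 3 ≤ G.degree x :=
    hx.ge.trans (Set.ncard_le_ncard Set.subset_union_left (Set.toFinite _))
  have heq : G.outNeighbors x = G.outNeighbors x ∪ G.inNeighbors x :=
    Set.eq_of_subset_of_ncard_le Set.subset_union_left ((h x).trans hx.ge) (Set.toFinite _)
  refine ⟨le_antisymm (h x) hle, Set.eq_empty_of_forall_notMem fun y hy => ?_⟩
  have hy' : y ∈ G.outNeighbors x := heq ▸ Or.inr hy
  exact hor _ _ hy' hy

theorem lowComponents_of_forall_component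
    (h : ∀ C : G.underlying.ConnectedComponent, ∃ x ∈ C.supp, G.degree x ≤ 2) :
    LowComponents G.Adj := by
  rintro X ⟨x, hx⟩ hX
  obtain ⟨y, hy, hdeg⟩ := h (G.underlying.connectedComponentMk x)
  refine ⟨y, ?_, fun hfull => by have := three_le_degree_of_full hfull; omega⟩
  obtain ⟨p⟩ := SimpleGraph.ConnectedComponent.exact hy
  clear hy hdeg
  induction p with
  | nil => exact hx
  | cons hadj p ih => exact hX _ (ih hx) _ hadj.2.symm

/-- Each of the excluded configurations contains a vertex of out-degree three adjacent to a vertex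
of in-degree three. -/
theorem adm_of_forall_not_adj (hor : G.IsOriented) (hG : G.IsSubcubic)
    (hcomp : ∀ C : G.underlying.ConnectedComponent, ∃ x ∈ C.supp, G.degree x ≤ 2)
    (h : ∀ u v : V, G.outDegree u = 3 → G.inDegree v = 3 → ¬ Nbr G.Adj u v) : Adm G.Adj where
  asymm := hor
  cubic := subcubic_of_isSubcubic hG
  low := lowComponents_of_forall_component hcomp
  noObs := fun X hX => by
    obtain ⟨h0, h1, h2, h3, h4, h5, h6, h7⟩ := hX.arcs
    obtain ⟨⟨n02, n03, n04, n12, n13, n14⟩, -⟩ := hX.ne_of_asymm hor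
    exact h _ _ (outDegree_eq_three hG hX.ne23 hX.ne52.symm hX.ne53.symm h0 h1 h6)
      (inDegree_eq_three hG hX.ne01 n04 n14 h0 h2 h4) (.inl h0)
  noObs' := fun X hX => by
    obtain ⟨h0, h1, h2, h3, h4, h5, h6, h7⟩ := hX.arcs
    obtain ⟨⟨n02, n03, n04, n12, n13, n14⟩, -⟩ := hX.ne_of_asymm (Asymm.flip hor)
    exact h _ _ (outDegree_eq_three hG hX.ne01 n04 n14 h0 h2 h4)
      (inDegree_eq_three hG hX.ne23 hX.ne52.symm hX.ne53.symm h0 h1 h6) (.inl h0)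
  noBlock := fun X hX => by
    obtain ⟨h0, h1, h2, h3, h4, h5, h6⟩ := hX.arcs
    obtain ⟨⟨n01, n02, n03, n12, n13⟩, -⟩ := hX.ne_of_asymm hor (subcubic_of_isSubcubic hG)
    exact h _ _ (outDegree_eq_three hG n12 n13 hX.ne23 h0 h1 h2)
      (inDegree_eq_three hG n02 n03 hX.ne23 h0 h3 h4) (.inl h0)

end Degree

end PaleySeven

theorem mainTheorem2 {V : Type*} [Finite V] (G : Digraph V) (hor : G.IsOriented)
    (hG : G.IsProperlySubcubic)
    (hcomp : ∀ C : G.underlying.ConnectedComponent, ∃ x ∈ C.supp, G.degree x ≤ 2) :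
    ((∀ u v : V, G.outDegree u = 3 → G.inDegree v = 3 → ¬ G.underlying.Adj u v) →
      G.AdmitsHom Digraph.QR7) ∧
    ((∀ x : V, G.degree x = 3 → ¬ G.IsSource x ∧ ¬ G.IsSink x) →
      G.AdmitsHom Digraph.QR7) := by
  have key : (∀ u v : V, G.outDegree u = 3 → G.inDegree v = 3 → ¬ PaleySeven.Nbr G.Adj u v) →
      G.AdmitsHom Digraph.QR7 := fun h => by
    obtain ⟨ψ, hψ⟩ := (PaleySeven.adm_of_forall_not_adj hor hG.1 hcomp h).colorable
    exact ⟨ψ, fun u v huv => (PaleySeven.adj_iff _ _).2 (hψ u v huv)⟩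
  refine ⟨fun h => key fun u v hu hv huv => h u v hu hv ?_, fun h => key fun u v hu _ _ => ?_⟩
  · refine ⟨?_, huv⟩
    rintro rfl
    exact huv.elim (fun h => hor _ _ h h) fun h => hor _ _ h h
  · obtain ⟨hdeg, hsrc⟩ := PaleySeven.isSource_of_outDegree_eq_three hor hG.1 hu
    exact (h u hdeg).1 hsrc
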